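/- Let $G$ be a finite group. An operad in $G$-sets is a symmetric operad $\mathcal O$ in sets (right $\Sigma_n$-actions on $\mathcal O(n)$, a unit, compositions $\gamma$) with left $G$-actions on the sets $\mathcal O(n)$ for which all structure maps are equivariant; operads in $G$-categories are defined likewise. Let $P_G$ be the operad in $G$-sets with $P_G(n)=\{f\colon G\to\Sigma_n\}$ (all functions), $(g\cdot f)(h)=f(hg)$, the pointwise right $\Sigma_n$-action by multiplication, and pointwise composition $\gamma(\sigma;\tau_1,\dots,\tau_n)=\sigma\langle k_1,\dots,k_n\rangle\cdot(\tau_1\oplus\cdots\oplus\tau_n)$ for $\sigma\in\Sigma_n$, $\tau_i\in\Sigma_{k_i}$, where $\sigma\langle k_1,\dots,k_n\rangle$ is the block permutation. The chaotic category $\widetilde X$ on a set $X$ has object set $X$ and exactly one morphism between any two objects; applied in each arity it turns an operad in $G$-sets into an operad in $G$-categories. The categorical $G$-Barratt–Eccles operad is $\mathcal P_G=\widetilde{P_G}$. For a finite $G$-set $T$ with a total order, let $\otimes_T\in P_G(|T|)$ be its permutation representation $G\to\Sigma_{|T|}$. Let $\mathfrak O$ be a complete set of ordered $G$-orbits, that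 is, a set of finite totally ordered transitive $G$-sets that contains exactly one non-trivial (i.e. not one-point) transitive $G$-set of each isomorphism class, orders being disregarded for isomorphism. Let $Q_{G,\mathfrak O}\subseteq P_G$ be the suboperad (in $G$-sets) generated by the elements $\otimes_T$ with $T\in\mathfrak O\cup\{\varnothing,\{0<1\}\}$, where $\{0,1\}$ has trivial action (so the generators are the unit $e=\otimes_\varnothing$, the product $\otimes=\otimes_{\{0,1\}}$ and the norms for the orbits in $\mathfrak O$), and let $\mathcal Q_{G,\mathfrak O}=\widetilde{Q_{G,\mathfrak O}}$. **Theorem.** For every finite group $G$ and every complete set $\mathfrak O$ of ordered $G$-orbits: 1. The operad $Q_{G,\mathfrak O}$ is finitely generated as an operad in $G$-sets. 2. $\mathcal Q_{G,\mathfrak O}$ is a genuine $E_\infty$ $G$-operad. That is, writing $B$ for the classifying space (the geometric realization of the nerve) and letting $G\times\Sigma_n$ act by $(g,\sigma)\cdot x=g\cdot x\cdot\sigma^{-1}$, it is $N_\infty$: $B\mathcal Q_{G,\mathfrak O}(0)$ is $G$-contractible; $\Sigma_n$ acts freely on $B\mathcal Q_{G,\mathfrak O}(n)$ for all $n\ge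 0$; and for each $n$ there is a family $\mathcal F_n$ of subgroups of $G\times\Sigma_n$, closed under subgroups and conjugation and containing $H\times\{1\}$ for all $H\le G$, such that for every subgroup $\Gamma\le G\times\Sigma_n$ the fixed point space $(B\mathcal Q_{G,\mathfrak O}(n))^\Gamma$ is contractible if $\Gamma\in\mathcal F_n$ and empty otherwise. Moreover it contains all norms: for all $n$, all $H\le G$ and all homomorphisms $\varphi\colon H\to\Sigma_n$, the graph $\{(h,\varphi(h)) : h\in H\}$ belongs to $\mathcal F_n$. 3. The inclusion $\mathcal Q_{G,\mathfrak O}\hookrightarrow\mathcal P_G$ is an equivalence of operads in $G$-categories: for all $n\ge0$ and all subgroups $\Gamma\le G\times\Sigma_n$, the functor of fixed point categories $\mathcal Q_{G,\mathfrak O}(n)^\Gamma\to\mathcal P_G(n)^\Gamma$ induces a weak homotopy equivalence of classifying spaces. -/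

import Mathlib

open CategoryTheory Equiv

universe u v w

noncomputable section

/-! ### Block permutations -/

/-- Transport of an element of a family indexed by arities along an equality of arities. -/
def arityCast {X : ℕ → Type v} {m n : ℕ} (h : m = n) (x : X m) : X n := h ▸ x

/-- The block sum `τ₁ ⊕ ⋯ ⊕ τₙ`, which permutes the `i`-th block through `τᵢ`. -/
def blockSum {n : ℕ} {k : Fin n → ℕ} (τ : ∀ i, Perm (Fin (k i))) : Perm (Fin (∑ i, k i)) :=
  finSigmaFinEquiv.symm.trans ((Equiv.sigmaCongrRight τ).trans finSigmaFinEquiv)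

theorem sum_comp_inv {n : ℕ} (σ : Perm (Fin n)) (k : Fin n → ℕ) :
    ∑ i, k (σ⁻¹ i) = ∑ i, k i := Equiv.sum_comp σ⁻¹ k

/-- The block permutation `σ⟨k₁, …, kₙ⟩`: the block number `i` of size `kᵢ` is moved, in order,
to the place number `σ i`. (After the move, the block in place `i` has size `k (σ⁻¹ i)`.) -/
def blockPerm {n : ℕ} (σ : Perm (Fin n)) (k : Fin n → ℕ) : Perm (Fin (∑ i, k i)) :=
  finSigmaFinEquiv.symm.trans
    ((Equiv.sigmaCongrLeft' (β := fun i => Fin (k i)) σ).trans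
      ((finSigmaFinEquiv (n := fun i => k (σ⁻¹ i))).trans (finCongr (sum_comp_inv σ k))))

/-- The permuted block sum `σ⟨τ₁, …, τₙ⟩ = σ⟨k₁, …, kₙ⟩ · (τ₁ ⊕ ⋯ ⊕ τₙ)`. -/
def permutedBlockSum {n : ℕ} {k : Fin n → ℕ} (σ : Perm (Fin n)) (τ : ∀ i, Perm (Fin (k i))) :
    Perm (Fin (∑ i, k i)) :=
  blockPerm σ k * blockSum τ

theorem sum_flatten {n : ℕ} (k : Fin n → ℕ) (l : ∀ i, Fin (k i) → ℕ) :
    ∑ p : Fin (∑ i, k i), l (finSigmaFinEquiv.symm p).1 (finSigmaFinEquiv.symm p).2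
      = ∑ i, ∑ j, l i j := by
  rw [Equiv.sum_comp finSigmaFinEquiv.symm (fun q : (i : Fin n) × Fin (k i) => l q.1 q.2),
    Fintype.sum_sigma]

theorem sum_const_fin_one (n : ℕ) : n = ∑ _i : Fin 1, n := by simp

theorem sum_one_fin (n : ℕ) : n = ∑ _i : Fin n, 1 := by simp

/-! ### Values of the block permutations -/

theorem sum_ite_lt_one {n : ℕ} (a : Fin n) : (∑ i, if i < a then 1 else 0) = (a : ℕ) := by
  rw [← Finset.sum_filter, ← Finset.card_eq_sum_ones]
  have : Finset.univ.filter (fun i => i < a) = Finset.Iio a := by ext; simp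
  rw [this, Fin.card_Iio]

theorem sum_ite_perm {n : ℕ} (σ : Perm (Fin n)) (k : Fin n → ℕ) (a : Fin n) :
    (∑ i, if i < a then k (σ⁻¹ i) else 0) = ∑ i, if σ i < a then k i else 0 := by
  rw [← Equiv.sum_comp σ (fun i => if i < a then k (σ⁻¹ i) else 0)]
  simp

theorem val_finSigmaFinEquiv {n : ℕ} {k : Fin n → ℕ} (i : Fin n) (j : Fin (k i)) :
    (finSigmaFinEquiv ⟨i, j⟩ : ℕ) = (∑ i', if i' < i then k i' else 0) + j := by
  rw [finSigmaFinEquiv_apply]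
  congr 1
  rw [← Finset.sum_filter]
  refine Finset.sum_bij (fun a _ => Fin.castLE i.2.le a) ?_ ?_ ?_ ?_
  · intro a _
    simp only [Finset.mem_filter, Finset.mem_univ, true_and]
    exact a.2
  · intro a _ b _ h; simpa [Fin.ext_iff] using h
  · intro b hb
    simp only [Finset.mem_filter, Finset.mem_univ, true_and] at hb
    exact ⟨⟨b, hb⟩, Finset.mem_univ _, rfl⟩
  · intro a _; rfl

theorem val_dep_perm {n : ℕ} {k : Fin n → ℕ} (τ : ∀ i, Perm (Fin (k i))) {a b : Fin n}
    (h : a = b) (x : Fin (k a)) (y : Fin (k b)) (hxy : (x : ℕ) = y) :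
    (τ a x : ℕ) = τ b y := by
  subst h
  rw [Fin.ext hxy]

theorem blockPerm_apply {n : ℕ} {k : Fin n → ℕ} (σ : Perm (Fin n)) (i : Fin n)
    (j : Fin (k i)) :
    ∃ j' : Fin (k (σ⁻¹ (σ i))), (j' : ℕ) = j ∧
      blockPerm σ k (finSigmaFinEquiv ⟨i, j⟩) =
        Fin.cast (sum_comp_inv σ k)
          (finSigmaFinEquiv (n := fun i => k (σ⁻¹ i)) ⟨σ i, j'⟩) := by
  have hi : σ⁻¹ (σ i) = i := by simp
  refine ⟨Fin.cast (by rw [hi]) j, rfl, ?_⟩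
  have key : (Equiv.sigmaCongrLeft' (β := fun i => Fin (k i)) σ) ⟨i, j⟩ =
      ⟨σ i, Fin.cast (by rw [← Perm.inv_def, hi]) j⟩ := by
    rw [Equiv.sigmaCongrLeft', Equiv.symm_apply_eq]
    refine Sigma.ext hi.symm ?_
    simp only [Equiv.sigmaCongrLeft, Equiv.coe_fn_mk]
    exact (Fin.heq_ext_iff (by simp)).2 rfl
  simp only [blockPerm, Equiv.trans_apply, Equiv.symm_apply_apply, key]
  rfl

theorem val_blockPerm {n : ℕ} {k : Fin n → ℕ} (σ : Perm (Fin n)) (i : Fin n) (j : Fin (k i)) :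
    (blockPerm σ k (finSigmaFinEquiv ⟨i, j⟩) : ℕ) =
      (∑ i', if σ i' < σ i then k i' else 0) + j := by
  obtain ⟨j', hj, h⟩ := blockPerm_apply σ i j
  rw [h, Fin.val_cast, val_finSigmaFinEquiv, sum_ite_perm, hj]

theorem blockSum_apply {n : ℕ} {k : Fin n → ℕ} (τ : ∀ i, Perm (Fin (k i))) (i : Fin n)
    (j : Fin (k i)) :
    blockSum τ (finSigmaFinEquiv ⟨i, j⟩) = finSigmaFinEquiv ⟨i, τ i j⟩ := by
  simp [blockSum]

theorem val_permutedBlockSum {n : ℕ} {k : Fin n → ℕ} (σ : Perm (Fin n))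
    (τ : ∀ i, Perm (Fin (k i))) (i : Fin n) (j : Fin (k i)) :
    (permutedBlockSum σ τ (finSigmaFinEquiv ⟨i, j⟩) : ℕ) =
      (∑ i', if σ i' < σ i then k i' else 0) + τ i j := by
  rw [permutedBlockSum, Perm.mul_apply, blockSum_apply, val_blockPerm]

theorem permutedBlockSum_lt_iff {n : ℕ} {k : Fin n → ℕ} (σ : Perm (Fin n))
    (τ : ∀ i, Perm (Fin (k i))) (i i' : Fin n) (j : Fin (k i)) (j' : Fin (k i')) :
    permutedBlockSum σ τ (finSigmaFinEquiv ⟨i', j'⟩) <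
        permutedBlockSum σ τ (finSigmaFinEquiv ⟨i, j⟩) ↔
      σ i' < σ i ∨ (i' = i ∧ (τ i' j' : ℕ) < τ i j) := by
  have aux : ∀ (a b : Fin n) (x : Fin (k a)) (y : Fin (k b)), σ a < σ b →
      permutedBlockSum σ τ (finSigmaFinEquiv ⟨a, x⟩) <
        permutedBlockSum σ τ (finSigmaFinEquiv ⟨b, y⟩) := by
    intro a b x y hab
    rw [Fin.lt_def, val_permutedBlockSum, val_permutedBlockSum]
    have h1 : (∑ c, if σ c < σ a then k c else 0) + k a ≤ ∑ c, if σ c < σ b then k c else 0 := by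
      calc (∑ c, if σ c < σ a then k c else 0) + k a
          = ∑ c, ((if σ c < σ a then k c else 0) + if c = a then k c else 0) := by
            rw [Finset.sum_add_distrib]; simp
        _ ≤ _ := by
            refine Finset.sum_le_sum fun c _ => ?_
            by_cases hc : c = a
            · subst hc; simp [hab]
            · by_cases h2 : σ c < σ a
              · simp [hc, h2, h2.trans hab]
              · simp [hc, h2]
    have h2 := (τ a x).2
    omega
  rcases lt_trichotomy (σ i') (σ i) with h | h | h
  · simp [h, aux _ _ j' j h]
  · have h' : i' = i := σ.injective h
    subst h'
    rw [Fin.lt_def, val_permutedBlockSum, val_permutedBlockSum]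
    simp
  · have h3 := aux _ _ j j' h
    have h4 : i' ≠ i := fun e => by subst e; exact lt_irrefl _ h
    simp [h4, not_lt.2 h.le, not_lt.2 h3.le]

theorem val_arityCast_perm {m n : ℕ} (h : m = n) (π : Perm (Fin m)) (x : Fin n) :
    (arityCast (X := fun n => Perm (Fin n)) h π x : ℕ) = π (Fin.cast h.symm x) := by
  subst h; rfl

theorem finSigma_ext {n : ℕ} {k : Fin n → ℕ} {π π' : Perm (Fin (∑ i, k i))}
    (h : ∀ i (j : Fin (k i)), (π (finSigmaFinEquiv ⟨i, j⟩) : ℕ) = π' (finSigmaFinEquiv ⟨i, j⟩)) :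
    π = π' := by
  ext x
  obtain ⟨⟨i, j⟩, rfl⟩ := finSigmaFinEquiv.surjective x
  exact h i j

theorem permutedBlockSum_one_left {n : ℕ} (τ : Perm (Fin n)) :
    permutedBlockSum (n := 1) (k := fun _ => n) 1 (fun _ => τ) =
      arityCast (X := fun n => Perm (Fin n)) (sum_const_fin_one n) τ := by
  refine finSigma_ext fun i j => ?_
  rw [val_permutedBlockSum, val_arityCast_perm]
  have : Fin.cast (sum_const_fin_one n).symm (finSigmaFinEquiv ⟨i, j⟩) = j := by
    ext; rw [Fin.val_cast, finSigmaFinEquiv_one]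
  rw [this]
  simp [Subsingleton.elim i 0]

theorem permutedBlockSum_one_right {n : ℕ} (σ : Perm (Fin n)) :
    permutedBlockSum (k := fun _ => 1) σ (fun _ => 1) =
      arityCast (X := fun n => Perm (Fin n)) (sum_one_fin n) σ := by
  refine finSigma_ext fun i j => ?_
  have hj : j = 0 := Subsingleton.elim _ _
  subst hj
  rw [val_permutedBlockSum, val_arityCast_perm]
  have : Fin.cast (sum_one_fin n).symm (finSigmaFinEquiv ⟨i, 0⟩) = i := by
    ext; rw [Fin.val_cast, val_finSigmaFinEquiv, sum_ite_lt_one]; simp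
  rw [this, ← sum_ite_perm σ (fun _ => 1), sum_ite_lt_one]
  simp

theorem permutedBlockSum_one_one {n : ℕ} {k : Fin n → ℕ} :
    permutedBlockSum (k := k) 1 (fun _ => 1) = 1 := by
  refine finSigma_ext fun i j => ?_
  rw [val_permutedBlockSum, Perm.one_apply]
  exact (val_finSigmaFinEquiv i j).symm

theorem val_permutedBlockSum_flatten {n : ℕ} {k : Fin n → ℕ} {l : ∀ i, Fin (k i) → ℕ}
    (σ : Perm (Fin n)) (τ : ∀ i, Perm (Fin (k i))) (ρ : ∀ i j, Perm (Fin (l i j)))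
    (i : Fin n) (j : Fin (k i)) (m : Fin (l i j))
    (m' : Fin (l (finSigmaFinEquiv.symm (finSigmaFinEquiv ⟨i, j⟩)).1
      (finSigmaFinEquiv.symm (finSigmaFinEquiv ⟨i, j⟩)).2)) (hm : (m' : ℕ) = m) :
    (permutedBlockSum
        (k := fun p => l (finSigmaFinEquiv.symm p).1 (finSigmaFinEquiv.symm p).2)
        (permutedBlockSum σ τ)
        (fun p => ρ (finSigmaFinEquiv.symm p).1 (finSigmaFinEquiv.symm p).2)
        (finSigmaFinEquiv ⟨finSigmaFinEquiv ⟨i, j⟩, m'⟩) : ℕ) =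
      permutedBlockSum σ (fun i => permutedBlockSum (τ i) (ρ i))
        (finSigmaFinEquiv ⟨i, finSigmaFinEquiv ⟨j, m⟩⟩) := by
  rw [val_permutedBlockSum, val_permutedBlockSum, val_permutedBlockSum, ← add_assoc]
  congr 1
  · rw [← Equiv.sum_comp (finSigmaFinEquiv (n := k)), Fintype.sum_sigma]
    have hl : ∀ i' (x : Fin (k i')), l (finSigmaFinEquiv.symm (finSigmaFinEquiv ⟨i', x⟩)).1
        (finSigmaFinEquiv.symm (finSigmaFinEquiv ⟨i', x⟩)).2 = l i' x := by
      intro i' x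
      rw [Equiv.symm_apply_apply]
    simp only [hl, permutedBlockSum_lt_iff]
    have h2 : (∑ j', if τ i j' < τ i j then l i j' else 0) =
        ∑ i', if i' = i then ∑ j' : Fin (k i'), (if (τ i' j' : ℕ) < τ i j then l i' j' else 0)
          else 0 := by
      rw [Finset.sum_ite_eq' Finset.univ i
        (fun i' => ∑ j' : Fin (k i'), (if (τ i' j' : ℕ) < τ i j then l i' j' else 0))]
      simp
    rw [h2, ← Finset.sum_add_distrib]
    refine Finset.sum_congr rfl fun i' _ => ?_
    by_cases h : i' = i
    · subst h; simp
    · by_cases h' : σ i' < σ i <;> simp [h, h']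
  · have aux : ∀ (q q' : (i : Fin n) × Fin (k i)) (_ : q = q') (x : Fin (l q.1 q.2))
        (y : Fin (l q'.1 q'.2)), (x : ℕ) = y → (ρ q.1 q.2 x : ℕ) = ρ q'.1 q'.2 y := by
      rintro q _ rfl x y hxy
      rw [Fin.ext hxy]
    exact aux _ ⟨i, j⟩ (Equiv.symm_apply_apply _ _) m' m hm

theorem permutedBlockSum_assoc {n : ℕ} {k : Fin n → ℕ} {l : ∀ i, Fin (k i) → ℕ}
    (σ : Perm (Fin n)) (τ : ∀ i, Perm (Fin (k i))) (ρ : ∀ i j, Perm (Fin (l i j))) :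
    arityCast (X := fun n => Perm (Fin n)) (sum_flatten k l)
      (permutedBlockSum
        (k := fun p => l (finSigmaFinEquiv.symm p).1 (finSigmaFinEquiv.symm p).2)
        (permutedBlockSum σ τ)
        (fun p => ρ (finSigmaFinEquiv.symm p).1 (finSigmaFinEquiv.symm p).2)) =
      permutedBlockSum σ (fun i => permutedBlockSum (τ i) (ρ i)) := by
  refine finSigma_ext fun i x => ?_
  obtain ⟨⟨j, m⟩, rfl⟩ := finSigmaFinEquiv.surjective x
  let m' : Fin (l (finSigmaFinEquiv.symm (finSigmaFinEquiv ⟨i, j⟩)).1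
      (finSigmaFinEquiv.symm (finSigmaFinEquiv ⟨i, j⟩)).2) :=
    Fin.cast (by rw [Equiv.symm_apply_apply]) m
  have hx : Fin.cast (sum_flatten k l).symm (finSigmaFinEquiv ⟨i, finSigmaFinEquiv ⟨j, m⟩⟩) =
      finSigmaFinEquiv ⟨finSigmaFinEquiv ⟨i, j⟩, m'⟩ := by
    have h := val_permutedBlockSum_flatten (k := k) (l := l) 1 (fun _ => 1) (fun _ _ => 1)
      i j m m' rfl
    simp only [permutedBlockSum_one_one, Perm.one_apply] at h
    exact Fin.ext h.symm
  rw [val_arityCast_perm, hx]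
  exact val_permutedBlockSum_flatten σ τ ρ i j m m' rfl

theorem permutedBlockSum_mul_left {n : ℕ} {k : Fin n → ℕ} (σ ρ : Perm (Fin n))
    (τ : ∀ i, Perm (Fin (k i))) :
    permutedBlockSum (σ * ρ) τ =
      arityCast (X := fun n => Perm (Fin n)) (sum_comp_inv ρ k)
        (permutedBlockSum (k := fun i => k (ρ⁻¹ i)) σ (fun i => τ (ρ⁻¹ i))) * blockPerm ρ k := by
  refine finSigma_ext fun i j => ?_
  obtain ⟨j', hj, h⟩ := blockPerm_apply ρ i j
  rw [Perm.mul_apply, h, val_arityCast_perm, Fin.cast_cast, Fin.cast_eq_self,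
    val_permutedBlockSum, val_permutedBlockSum,
    val_dep_perm τ (by simp : ρ⁻¹ (ρ i) = i) j' j hj]
  congr 1
  rw [← Equiv.sum_comp ρ (fun i' => if σ i' < σ (ρ i) then k (ρ⁻¹ i') else 0)]
  simp only [Perm.inv_def, Equiv.symm_apply_apply]
  rfl

theorem permutedBlockSum_mul_right {n : ℕ} {k : Fin n → ℕ} (σ : Perm (Fin n))
    (τ τ' : ∀ i, Perm (Fin (k i))) :
    permutedBlockSum σ (fun i => τ i * τ' i) = permutedBlockSum σ τ * blockSum τ' := by
  refine finSigma_ext fun i j => ?_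
  rw [Perm.mul_apply, blockSum_apply, val_permutedBlockSum, val_permutedBlockSum]
  rfl

/-! ### Operads in sets and in `G`-sets -/

/-- A (symmetric) operad in sets. -/
structure SetOperad where
  /-- The set of operations of each arity. -/
  Op : ℕ → Type v
  /-- The right action of `Σₙ`. -/
  sact : ∀ {n}, Op n → Perm (Fin n) → Op n
  /-- The unit. -/
  one : Op 1
  /-- The composition `γ(f; h₁, …, hₙ)`. -/
  comp : ∀ {n} {k : Fin n → ℕ}, Op n → (∀ i, Op (k i)) → Op (∑ i, k i)
  sact_one : ∀ {n} (f : Op n), sact f 1 = f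
  sact_mul : ∀ {n} (f : Op n) (σ τ : Perm (Fin n)), sact f (σ * τ) = sact (sact f σ) τ
  one_comp : ∀ {n} (f : Op n),
    comp (k := fun _ : Fin 1 => n) one (fun _ => f) = arityCast (sum_const_fin_one n) f
  comp_one : ∀ {n} (f : Op n),
    comp (k := fun _ : Fin n => 1) f (fun _ => one) = arityCast (sum_one_fin n) f
  assoc : ∀ {n} {k : Fin n → ℕ} {l : ∀ i, Fin (k i) → ℕ} (f : Op n) (h : ∀ i, Op (k i))
    (c : ∀ i j, Op (l i j)),
    arityCast (sum_flatten k l)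
      (comp (k := fun p => l (finSigmaFinEquiv.symm p).1 (finSigmaFinEquiv.symm p).2)
        (comp f h) (fun p => c (finSigmaFinEquiv.symm p).1 (finSigmaFinEquiv.symm p).2)) =
      comp f (fun i => comp (h i) (c i))
  sact_comp : ∀ {n} {k : Fin n → ℕ} (f : Op n) (σ : Perm (Fin n)) (h : ∀ i, Op (k i)),
    comp (sact f σ) h =
      sact (arityCast (sum_comp_inv σ k)
        (comp (k := fun i => k (σ⁻¹ i)) f (fun i => h (σ⁻¹ i)))) (blockPerm σ k)
  comp_sact : ∀ {n} {k : Fin n → ℕ} (f : Op n) (h : ∀ i, Op (k i))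
    (τ : ∀ i, Perm (Fin (k i))),
    comp f (fun i => sact (h i) (τ i)) = sact (comp f h) (blockSum τ)

/-- An operad in `G`-sets: an operad in sets whose structure maps are `G`-equivariant. -/
structure GSetOperad (G : Type u) [Group G] extends SetOperad.{v} where
  /-- The left action of `G`. -/
  gact : ∀ {n}, G → Op n → Op n
  gact_one : ∀ {n} (f : Op n), gact 1 f = f
  gact_mul : ∀ {n} (g h : G) (f : Op n), gact (g * h) f = gact g (gact h f)
  gact_sact : ∀ {n} (g : G) (f : Op n) (σ : Perm (Fin n)),
    gact g (sact f σ) = sact (gact g f) σ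
  gact_unit : ∀ g : G, gact g one = one
  gact_comp : ∀ {n} {k : Fin n → ℕ} (g : G) (f : Op n) (h : ∀ i, Op (k i)),
    gact g (comp f h) = comp (gact g f) (fun i => gact g (h i))

/-- The associativity operad. -/
def Assoc : SetOperad.{0} where
  Op n := Perm (Fin n)
  sact σ τ := σ * τ
  one := 1
  comp σ τ := permutedBlockSum σ τ
  sact_one σ := mul_one σ
  sact_mul f σ τ := (mul_assoc f σ τ).symm
  one_comp := permutedBlockSum_one_left
  comp_one := permutedBlockSum_one_right
  assoc := permutedBlockSum_assoc
  sact_comp := permutedBlockSum_mul_left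
  comp_sact := permutedBlockSum_mul_right

theorem arityCast_fun_apply {G : Type u} {X : ℕ → Type v} {m n : ℕ} (h : m = n)
    (f : G → X m) (g : G) :
    arityCast (X := fun n => G → X n) h f g = arityCast h (f g) := by
  subst h; rfl

/-- The operad `Set(G, O)` in `G`-sets, where `(g • f)(h) = f (h g)`. -/
def SetOperad.coinduced (G : Type u) [Group G] (O : SetOperad.{v}) :
    GSetOperad.{u, max u v} G where
  Op n := G → O.Op n
  sact f σ := fun x => O.sact (f x) σ
  one := fun _ => O.one
  comp f h := fun x => O.comp (f x) (fun i => h i x)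
  sact_one f := funext fun x => O.sact_one (f x)
  sact_mul f σ τ := funext fun x => O.sact_mul (f x) σ τ
  one_comp f := funext fun x => by
    rw [arityCast_fun_apply]; exact O.one_comp (f x)
  comp_one f := funext fun x => by
    rw [arityCast_fun_apply]; exact O.comp_one (f x)
  assoc f h c := funext fun x => by
    rw [arityCast_fun_apply]; exact O.assoc (f x) (fun i => h i x) (fun i j => c i j x)
  sact_comp f σ h := funext fun x => by
    rw [arityCast_fun_apply]; exact O.sact_comp (f x) σ (fun i => h i x)
  comp_sact f h τ := funext fun x => O.comp_sact (f x) (fun i => h i x) τ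
  gact g f := fun x => f (x * g)
  gact_one f := funext fun x => by simp
  gact_mul g h f := funext fun x => by simp [mul_assoc]
  gact_sact _ _ _ := rfl
  gact_unit _ := rfl
  gact_comp _ _ _ := rfl

/-- The object operad `P_G = Set(G, Assoc)` of the `G`-Barratt–Eccles operad. -/
def barrattEcclesObj (G : Type u) [Group G] : GSetOperad.{u, u} G := Assoc.coinduced G

/-! ### Suboperads and generation -/

namespace GSetOperad

variable {G : Type u} [Group G]

/-- A suboperad of an operad in `G`-sets. -/
structure Suboperad (O : GSetOperad.{u, v} G) where
  /-- The operations that belong to the suboperad. -/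
  carrier : ∀ n, Set (O.Op n)
  one_mem : O.one ∈ carrier 1
  sact_mem : ∀ {n} {f : O.Op n} (σ : Perm (Fin n)), f ∈ carrier n → O.sact f σ ∈ carrier n
  gact_mem : ∀ {n} {f : O.Op n} (g : G), f ∈ carrier n → O.gact g f ∈ carrier n
  comp_mem : ∀ {n} {k : Fin n → ℕ} {f : O.Op n} {h : ∀ i, O.Op (k i)},
    f ∈ carrier n → (∀ i, h i ∈ carrier (k i)) → O.comp f h ∈ carrier (∑ i, k i)

/-- The suboperad `⟨S⟩` generated by `S`: the smallest suboperad that contains `S`. -/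
def generated (O : GSetOperad.{u, v} G) (S : ∀ n, Set (O.Op n)) : O.Suboperad where
  carrier n := {f | ∀ N : O.Suboperad, (∀ m, S m ⊆ N.carrier m) → f ∈ N.carrier n}
  one_mem N _ := N.one_mem
  sact_mem σ hf N hN := N.sact_mem σ (hf N hN)
  gact_mem g hf N hN := N.gact_mem g (hf N hN)
  comp_mem hf hh N hN := N.comp_mem (hf N hN) (fun i => hh i N hN)

/-- An operad is finitely generated if it is generated by finitely many operations. -/
def IsFinitelyGenerated (O : GSetOperad.{u, v} G) : Prop :=
  ∃ S : ∀ n, Set (O.Op n), Finite (Σ n, S n) ∧ ∀ n, (O.generated S).carrier n = Set.univ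

theorem coe_arityCast {X : ℕ → Type v} (p : ∀ n, Set (X n)) {m n : ℕ} (h : m = n) (x : p m) :
    ((arityCast (X := fun n => p n) h x : p n) : X n) = arityCast h (x : X m) := by
  subst h; rfl

/-- A suboperad as an operad in its own right. -/
def Suboperad.toOperad {O : GSetOperad.{u, v} G} (N : O.Suboperad) : GSetOperad.{u, v} G where
  Op n := N.carrier n
  sact f σ := ⟨O.sact f σ, N.sact_mem σ f.2⟩
  one := ⟨O.one, N.one_mem⟩
  comp f h := ⟨O.comp f.1 (fun i => (h i).1), N.comp_mem f.2 (fun i => (h i).2)⟩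
  sact_one f := Subtype.ext (O.sact_one f.1)
  sact_mul f σ τ := Subtype.ext (O.sact_mul f.1 σ τ)
  one_comp f := Subtype.ext (by rw [coe_arityCast]; exact O.one_comp f.1)
  comp_one f := Subtype.ext (by rw [coe_arityCast]; exact O.comp_one f.1)
  assoc f h c := Subtype.ext (by
    rw [coe_arityCast]; exact O.assoc f.1 (fun i => (h i).1) (fun i j => (c i j).1))
  sact_comp f σ h := Subtype.ext
    ((O.sact_comp f.1 σ (fun i => (h i).1)).trans
      (congrArg (fun x => O.sact x (blockPerm σ _)) (coe_arityCast N.carrier (sum_comp_inv σ _)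
        ⟨_, N.comp_mem f.2 (fun i => (h (σ⁻¹ i)).2)⟩).symm))
  comp_sact f h τ := Subtype.ext (O.comp_sact f.1 (fun i => (h i).1) τ)
  gact g f := ⟨O.gact g f, N.gact_mem g f.2⟩
  gact_one f := Subtype.ext (O.gact_one f.1)
  gact_mul g h f := Subtype.ext (O.gact_mul g h f.1)
  gact_sact g f σ := Subtype.ext (O.gact_sact g f.1 σ)
  gact_unit g := Subtype.ext (O.gact_unit g)
  gact_comp g f h := Subtype.ext (O.gact_comp g f.1 (fun i => (h i).1))

/-- A map of operads in `G`-sets. -/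
structure Hom (N O : GSetOperad.{u, v} G) where
  /-- The components. -/
  app : ∀ n, N.Op n → O.Op n
  app_sact : ∀ {n} (f : N.Op n) (σ : Perm (Fin n)), app n (N.sact f σ) = O.sact (app n f) σ
  app_gact : ∀ {n} (g : G) (f : N.Op n), app n (N.gact g f) = O.gact g (app n f)
  app_one : app 1 N.one = O.one
  app_comp : ∀ {n} {k : Fin n → ℕ} (f : N.Op n) (h : ∀ i, N.Op (k i)),
    app _ (N.comp f h) = O.comp (app n f) (fun i => app (k i) (h i))

/-- The inclusion of a suboperad. -/
def Suboperad.incl {O : GSetOperad.{u, v} G} (N : O.Suboperad) : Hom N.toOperad O where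
  app n f := (show N.carrier n from f).1
  app_sact _ _ := rfl
  app_gact _ _ := rfl
  app_one := rfl
  app_comp _ _ := rfl

end GSetOperad

/-! ### Ordered `G`-sets, norms, and the complete suboperad -/

/-- A finite ordered `G`-set: a finite `G`-set with a total order, on whose compatibility with the
action nothing is required. -/
structure OrderedGSet (G : Type u) [Group G] where
  /-- The underlying set. -/
  carrier : Type v
  [fintype : Fintype carrier]
  [linearOrder : LinearOrder carrier]
  [mulAction : MulAction G carrier]

namespace OrderedGSet

attribute [instance] fintype linearOrder mulAction

variable {G : Type u} [Group G]

/-- The number of elements. -/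
def card (T : OrderedGSet.{u, v} G) : ℕ := Fintype.card T.carrier

/-- The permutation representation `⊗_T : G → Σ_{|T|}` of an ordered `G`-set `T`, where
`T` is identified with `{0, …, |T| - 1}` through its order: the external norm for `T`. -/
def norm (T : OrderedGSet.{u, v} G) : (barrattEcclesObj G).Op T.card := fun g =>
  (monoEquivOfFin T.carrier rfl).toEquiv.symm.permCongr (MulAction.toPerm g)

/-- The ordered set `{0 < ⋯ < n - 1}` with trivial action of `G`. -/
def trivial (G : Type u) [Group G] (n : ℕ) : OrderedGSet.{u, v} G where
  carrier := ULift.{v} (Fin n)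
  mulAction :=
    { smul := fun _ x => x
      one_smul := fun _ => rfl
      mul_smul := fun _ _ _ => rfl }

end OrderedGSet

/-- A set of ordered transitive `G`-sets is a complete set of ordered `G`-orbits if it contains
exactly one non-trivial transitive `G`-set of each isomorphism class (forgetting the order).
Transitive sets are non-empty, and the non-trivial ones have at least two elements. -/
structure IsCompleteSetOfOrbits {G : Type u} [Group G] (𝔒 : Set (OrderedGSet.{u, v} G)) :
    Prop where
  transitive : ∀ T ∈ 𝔒, Nonempty T.carrier ∧ MulAction.IsPretransitive G T.carrier
  existsUnique : ∀ (X : Type v) [MulAction G X] [MulAction.IsPretransitive G X] [Nontrivial X],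
    ∃! T : OrderedGSet.{u, v} G, T ∈ 𝔒 ∧ ∃ f : T.carrier →[G] X, Function.Bijective f

/-- The norms `⊗_T` for `T ∈ 𝔒 ∪ {∅, {0, 1}}`. -/
inductive NormGenerator {G : Type u} [Group G] (𝔒 : Set (OrderedGSet.{u, v} G)) :
    ∀ n, Set ((barrattEcclesObj G).Op n)
  | norm (T : OrderedGSet.{u, v} G)
      (hT : T ∈ 𝔒 ∪ {OrderedGSet.trivial G 0, OrderedGSet.trivial G 2}) :
      NormGenerator 𝔒 T.card T.norm

/-- The suboperad `Q_{G, 𝔒} = ⟨⊗_T | T ∈ 𝔒 ∪ {∅, {0, 1}}⟩` of `P_G`. -/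
def completeSuboperadObj (G : Type u) [Group G] (𝔒 : Set (OrderedGSet.{u, v} G)) :
    (barrattEcclesObj G).Suboperad :=
  (barrattEcclesObj G).generated (NormGenerator 𝔒)

/-! ### Operads in `G`-categories -/

/-- Transport of a family of categories along an equality of arities, as a functor. -/
def castFunctor (C : ℕ → Type v) [∀ n, Category.{w} (C n)] {m n : ℕ} (h : m = n) : C m ⥤ C n :=
  h ▸ 𝟭 (C m)

theorem castFunctor_obj (C : ℕ → Type v) [∀ n, Category.{w} (C n)] {m n : ℕ} (h : m = n)
    (x : C m) : (castFunctor C h).obj x = arityCast h x := by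
  subst h; rfl

set_option linter.checkUnivs false in
/-- An operad in `G`-categories. All identities are (strict) equalities of functors. -/
structure GCatOperad (G : Type u) [Group G] where
  /-- The category of operations of each arity. -/
  C : ℕ → Type v
  [category : ∀ n, Category.{w} (C n)]
  /-- The left action of `G`. -/
  gact : ∀ {n}, G → C n ⥤ C n
  /-- The right action of `Σₙ`. -/
  sact : ∀ {n}, Perm (Fin n) → C n ⥤ C n
  /-- The unit object. -/
  one : C 1
  /-- The composition. -/
  comp : ∀ {n} (k : Fin n → ℕ), C n × (∀ i, C (k i)) ⥤ C (∑ i, k i)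
  gact_one : ∀ n, gact (1 : G) = 𝟭 (C n)
  gact_mul : ∀ n (g h : G), (gact (g * h) : C n ⥤ C n) = gact h ⋙ gact g
  sact_one : ∀ n, sact (1 : Perm (Fin n)) = 𝟭 (C n)
  sact_mul : ∀ {n} (σ τ : Perm (Fin n)), sact (σ * τ) = sact σ ⋙ sact τ
  gact_sact : ∀ {n} (g : G) (σ : Perm (Fin n)), sact σ ⋙ gact g = gact g ⋙ sact σ
  gact_unit : ∀ g : G, (gact g).obj one = one
  gact_comp : ∀ {n} (k : Fin n → ℕ) (g : G),
    comp k ⋙ gact g = (gact g).prod (Functor.pi fun _ => gact g) ⋙ comp k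
  one_comp : ∀ n : ℕ,
    ((Functor.const (C n)).obj one).prod' (Functor.pi' fun _ : Fin 1 => 𝟭 (C n)) ⋙
      comp (fun _ : Fin 1 => n) = castFunctor C (sum_const_fin_one n)
  comp_one : ∀ n : ℕ,
    (𝟭 (C n)).prod' (Functor.pi' fun _ : Fin n => (Functor.const (C n)).obj one) ⋙
      comp (fun _ : Fin n => 1) = castFunctor C (sum_one_fin n)
  assoc : ∀ {n} (k : Fin n → ℕ) (l : ∀ i, Fin (k i) → ℕ),
    ((𝟭 (C n)).prod (CategoryTheory.Prod.fst (∀ i, C (k i)) (∀ i j, C (l i j))) ⋙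
        comp k).prod'
      (CategoryTheory.Prod.snd (C n) _ ⋙
        CategoryTheory.Prod.snd (∀ i, C (k i)) (∀ i j, C (l i j)) ⋙
        Functor.pi' fun p : Fin (∑ i, k i) =>
          Pi.eval (fun i => ∀ j, C (l i j)) (finSigmaFinEquiv.symm p).1 ⋙
          Pi.eval (fun j => C (l (finSigmaFinEquiv.symm p).1 j)) (finSigmaFinEquiv.symm p).2) ⋙
      comp (fun p => l (finSigmaFinEquiv.symm p).1 (finSigmaFinEquiv.symm p).2) ⋙
      castFunctor C (sum_flatten k l) =
    (CategoryTheory.Prod.fst (C n) ((∀ i, C (k i)) × (∀ i j, C (l i j)))).prod'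
      (Functor.pi' fun i =>
        CategoryTheory.Prod.snd (C n) ((∀ i, C (k i)) × (∀ i j, C (l i j))) ⋙
          (Pi.eval (fun i => C (k i)) i).prod (Pi.eval (fun i => ∀ j, C (l i j)) i) ⋙
          comp (l i)) ⋙
      comp (fun i => ∑ j, l i j)
  sact_comp : ∀ {n} (k : Fin n → ℕ) (σ : Perm (Fin n)),
    (sact σ).prod (𝟭 (∀ i, C (k i))) ⋙ comp k =
      (𝟭 (C n)).prod (Functor.pi' fun i => Pi.eval (fun i => C (k i)) (σ⁻¹ i)) ⋙
        comp (fun i => k (σ⁻¹ i)) ⋙ castFunctor C (sum_comp_inv σ k) ⋙ sact (blockPerm σ k)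
  comp_sact : ∀ {n} (k : Fin n → ℕ) (τ : ∀ i, Perm (Fin (k i))),
    (𝟭 (C n)).prod (Functor.pi fun i => sact (τ i)) ⋙ comp k = comp k ⋙ sact (blockSum τ)

theorem codiscrete_functor_ext {C : Type*} [Category* C] {A : Type*} {F H : C ⥤ Codiscrete A}
    (h : ∀ x, F.obj x = H.obj x) : F = H :=
  CategoryTheory.Functor.ext h (fun _ _ _ => Subsingleton.elim _ _)

theorem arityCast_codiscrete {X : ℕ → Type v} {m n : ℕ} (h : m = n) (x : X m) :
    arityCast (X := fun n => Codiscrete (X n)) h ⟨x⟩ = ⟨arityCast h x⟩ := by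
  subst h; rfl

/-- The chaotic operad on an operad in `G`-sets. -/
def GSetOperad.chaotic {G : Type u} [Group G] (O : GSetOperad.{u, v} G) :
    GCatOperad.{u, v, 0} G where
  C n := Codiscrete (O.Op n)
  gact g := Codiscrete.functorOfFun (O.gact g)
  sact σ := Codiscrete.functorOfFun (fun f => O.sact f σ)
  one := ⟨O.one⟩
  comp k := Codiscrete.functor (fun x => O.comp x.1.as (fun i => (x.2 i).as))
  gact_one n := codiscrete_functor_ext fun x => Codiscrete.ext (O.gact_one x.as)
  gact_mul n g h := codiscrete_functor_ext fun x => Codiscrete.ext (O.gact_mul g h x.as)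
  sact_one n := codiscrete_functor_ext fun x => Codiscrete.ext (O.sact_one x.as)
  sact_mul σ τ := codiscrete_functor_ext fun x => Codiscrete.ext (O.sact_mul x.as σ τ)
  gact_sact g σ := codiscrete_functor_ext fun x => Codiscrete.ext (O.gact_sact g x.as σ)
  gact_unit g := Codiscrete.ext (O.gact_unit g)
  gact_comp k g := codiscrete_functor_ext fun x =>
    Codiscrete.ext (O.gact_comp g x.1.as (fun i => (x.2 i).as))
  one_comp n := codiscrete_functor_ext fun x => by
    rw [castFunctor_obj]
    exact (congrArg Codiscrete.mk (O.one_comp x.as)).trans (arityCast_codiscrete _ x.as).symm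
  comp_one n := codiscrete_functor_ext fun x => by
    rw [castFunctor_obj]
    exact (congrArg Codiscrete.mk (O.comp_one x.as)).trans (arityCast_codiscrete _ x.as).symm
  assoc k l := codiscrete_functor_ext fun x =>
    (castFunctor_obj _ _ _).trans ((arityCast_codiscrete _ _).trans (congrArg Codiscrete.mk
      (O.assoc x.1.as (fun i => (x.2.1 i).as) (fun i j => (x.2.2 i j).as))))
  sact_comp k σ := codiscrete_functor_ext fun x =>
    (congrArg Codiscrete.mk (O.sact_comp x.1.as σ (fun i => (x.2 i).as))).trans
      (congrArg (Codiscrete.functorOfFun (fun f => O.sact f (blockPerm σ k))).obj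
        ((castFunctor_obj _ _ _).trans (arityCast_codiscrete _ _)).symm)
  comp_sact k τ := codiscrete_functor_ext fun x =>
    Codiscrete.ext (O.comp_sact x.1.as (fun i => (x.2 i).as) τ)

namespace GCatOperad

attribute [instance] category

variable {G : Type u} [Group G]

/-- The left action of `G × Σₙ` on the operations of arity `n`:
`(g, σ) • f = g • f • σ⁻¹`. -/
def act (O : GCatOperad.{u, v, w} G) (n : ℕ) (γ : G × Perm (Fin n)) : O.C n ⥤ O.C n :=
  O.sact γ.2⁻¹ ⋙ O.gact γ.1

theorem act_one (O : GCatOperad.{u, v, w} G) (n : ℕ) : O.act n 1 = 𝟭 (O.C n) := by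
  simp [act, O.gact_one, O.sact_one, Functor.comp_id]

theorem act_mul (O : GCatOperad.{u, v, w} G) (n : ℕ) (γ δ : G × Perm (Fin n)) :
    O.act n (γ * δ) = O.act n δ ⋙ O.act n γ := by
  simp only [act, Prod.fst_mul, Prod.snd_mul, mul_inv_rev, O.gact_mul, O.sact_mul]
  rw [Functor.assoc, Functor.assoc, ← Functor.assoc (O.gact δ.1), ← O.gact_sact]
  rfl

/-- A map of operads in `G`-categories. -/
structure Hom (N O : GCatOperad.{u, v, w} G) where
  /-- The components. -/
  app : ∀ n, N.C n ⥤ O.C n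
  app_sact : ∀ {n} (σ : Perm (Fin n)), N.sact σ ⋙ app n = app n ⋙ O.sact σ
  app_gact : ∀ (n : ℕ) (g : G), N.gact g ⋙ app n = app n ⋙ O.gact g
  app_one : (app 1).obj N.one = O.one
  app_comp : ∀ {n} (k : Fin n → ℕ),
    N.comp k ⋙ app _ = (app n).prod (Functor.pi fun i => app (k i)) ⋙ O.comp k

theorem Hom.app_act {N O : GCatOperad.{u, v, w} G} (φ : Hom N O) (n : ℕ)
    (γ : G × Perm (Fin n)) : N.act n γ ⋙ φ.app n = φ.app n ⋙ O.act n γ := by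
  rw [act, Functor.assoc, φ.app_gact, ← Functor.assoc, φ.app_sact, Functor.assoc]
  rfl

end GCatOperad

/-- The map of chaotic operads induced by a map of operads in `G`-sets. -/
def GSetOperad.Hom.chaotic {G : Type u} [Group G] {N O : GSetOperad.{u, v} G}
    (φ : GSetOperad.Hom N O) : GCatOperad.Hom N.chaotic O.chaotic where
  app n := Codiscrete.functorOfFun (φ.app n)
  app_sact σ := codiscrete_functor_ext fun x => Codiscrete.ext (φ.app_sact x.as σ)
  app_gact n g := codiscrete_functor_ext fun x => Codiscrete.ext (φ.app_gact g x.as)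
  app_one := Codiscrete.ext φ.app_one
  app_comp k := codiscrete_functor_ext fun x =>
    Codiscrete.ext (φ.app_comp x.1.as (fun i => (x.2 i).as))

/-! ### Fixed point categories -/

/-- The objects of the fixed point category of a subgroup `Γ ≤ K`, for a family of endofunctors
`A` that is indexed by `K`. -/
@[ext]
structure FixedCategory {K : Type u} [Group K] {C : Type v} [Category.{w} C] (A : K → C ⥤ C)
    (Γ : Subgroup K) where
  /-- The underlying object. -/
  obj : C
  fixed : ∀ γ ∈ Γ, (A γ).obj obj = obj

namespace FixedCategory

variable {K : Type u} [Group K] {C D : Type v} [Category.{w} C] [Category.{w} D]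
  {A : K → C ⥤ C} {B : K → D ⥤ D} {Γ : Subgroup K}

/-- The morphisms are those with `γ • f = f` for all `γ ∈ Γ`. -/
instance : Category (FixedCategory A Γ) where
  Hom X Y := {f : X.obj ⟶ Y.obj // ∀ (γ : K) (hγ : γ ∈ Γ), (A γ).map f =
    eqToHom (X.fixed γ hγ) ≫ f ≫ eqToHom (Y.fixed γ hγ).symm}
  id X := ⟨𝟙 X.obj, fun γ hγ => by simp⟩
  comp f g := ⟨f.1 ≫ g.1, fun γ hγ => by simp [f.2 γ hγ, g.2 γ hγ]⟩
  id_comp f := Subtype.ext (Category.id_comp f.1)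
  comp_id f := Subtype.ext (Category.comp_id f.1)
  assoc f g h := Subtype.ext (Category.assoc f.1 g.1 h.1)

/-- The functor that an equivariant functor induces on fixed points. -/
def map (F : C ⥤ D) (hF : ∀ γ, A γ ⋙ F = F ⋙ B γ) (Γ : Subgroup K) :
    FixedCategory A Γ ⥤ FixedCategory B Γ where
  obj X := ⟨F.obj X.obj, fun γ hγ =>
    (Functor.congr_obj (hF γ) X.obj).symm.trans (congrArg F.obj (X.fixed γ hγ))⟩
  map f := ⟨F.map f.1, fun γ hγ => by
    have h := Functor.congr_hom (hF γ).symm f.1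
    simp only [Functor.comp_map] at h
    rw [h, f.2 γ hγ]
    simp [eqToHom_map]⟩
  map_id X := Subtype.ext (F.map_id X.obj)
  map_comp f g := Subtype.ext (F.map_comp f.1 g.1)

end FixedCategory

/-! ### Classifying spaces and weak equivalences -/

/-- The classifying space of a category: the geometric realization of its nerve. -/
def classifyingSpace (C : Type v) [Category.{w} C] : TopCat.{max v w} :=
  SSet.toTop.obj (nerve C)

/-- The map of classifying spaces that is induced by a functor. -/
def classifyingMap {C D : Type v} [Category.{w} C] [Category.{w} D] (F : C ⥤ D) :
    classifyingSpace C ⟶ classifyingSpace D :=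
  SSet.toTop.map (nerveMap F)

theorem classifyingMap_id (C : Type v) [Category.{w} C] :
    classifyingMap (𝟭 C) = 𝟙 (classifyingSpace C) :=
  SSet.toTop.map_id (nerve C)

theorem classifyingMap_comp {C D E : Type v} [Category.{w} C] [Category.{w} D] [Category.{w} E]
    (F : C ⥤ D) (H : D ⥤ E) :
    classifyingMap (F ⋙ H) = classifyingMap F ≫ classifyingMap H :=
  SSet.toTop.map_comp (nerveMap F) (nerveMap H)

/-- The map `πₙ(X, x) → πₙ(Y, f x)` that is induced by a continuous map. -/
def homotopyGroupMap {X : Type v} {Y : Type w} [TopologicalSpace X] [TopologicalSpace Y]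
    (f : C(X, Y)) (n : ℕ) (x : X) : HomotopyGroup.Pi n X x → HomotopyGroup.Pi n Y (f x) :=
  Quotient.map (fun p => ⟨f.comp p.1, fun y hy => congrArg f (p.2 y hy)⟩)
    (fun _ _ h => h.comp_continuousMap f)

/-- A weak homotopy equivalence: a continuous map that induces bijections on path components and
on all homotopy groups, for all base points. -/
structure IsWeakHomotopyEquiv {X : Type v} {Y : Type w} [TopologicalSpace X] [TopologicalSpace Y]
    (f : C(X, Y)) : Prop where
  bijective_zeroth : Function.Bijective
    (Quotient.map f (fun _ _ h => h.map f.continuous) : ZerothHomotopy X → ZerothHomotopy Y)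
  bijective_pi : ∀ (n : ℕ) (x : X), Function.Bijective (homotopyGroupMap f n x)

/-! ### Equivalences, `N_∞` operads and genuine `E_∞` operads -/

/-- A universal space for the set `F` of subgroups of `K`: a `K`-space whose `Γ`-fixed points are
contractible for `Γ ∈ F` and empty otherwise. -/
def IsUniversalSpace (K : Type u) [Group K] (F : Set (Subgroup K)) (X : Type v)
    [TopologicalSpace X] [MulAction K X] : Prop :=
  ∀ Γ : Subgroup K,
    (Γ ∈ F → ContractibleSpace (MulAction.fixedPoints Γ X)) ∧
    (Γ ∉ F → IsEmpty (MulAction.fixedPoints Γ X))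

/-- A family of subgroups: a set of subgroups closed under passage to subgroups and
under conjugation. -/
structure IsFamilyOfSubgroups {K : Type u} [Group K] (F : Set (Subgroup K)) : Prop where
  mem_of_le : ∀ {Γ Δ : Subgroup K}, Γ ∈ F → Δ ≤ Γ → Δ ∈ F
  conj_mem : ∀ {Γ : Subgroup K} (k : K), Γ ∈ F → Γ.map (MulAut.conj k).toMonoidHom ∈ F

/-- A `K`-space is `K`-contractible if there is a `K`-equivariant homotopy from the identity to
the constant map at a `K`-fixed point. -/
def IsEquivariantlyContractible (K : Type u) [Group K] (X : Type v) [TopologicalSpace X]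
    [MulAction K X] : Prop :=
  ∃ x₀ : X, (∀ k : K, k • x₀ = x₀) ∧
    ∃ H : (ContinuousMap.id X).Homotopy (ContinuousMap.const X x₀),
      ∀ (k : K) (t : unitInterval) (x : X), H (t, k • x) = k • H (t, x)

/-- The graph `{(h, φ h) | h ∈ H}` of a homomorphism from a subgroup `H ≤ G`. -/
def graphSubgroup {G : Type u} [Group G] {n : ℕ} (H : Subgroup G) (φ : H →* Perm (Fin n)) :
    Subgroup (G × Perm (Fin n)) :=
  (H.subtype.prod φ).range

namespace GCatOperad

variable {G : Type u} [Group G]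

/-- A map of operads in `G`-categories is an equivalence if for all `Γ ≤ G × Σₙ` the functor on
`Γ`-fixed points is a weak equivalence on classifying spaces. -/
def Hom.IsEquivalence {N O : GCatOperad.{u, v, w} G} (φ : Hom N O) : Prop :=
  ∀ (n : ℕ) (Γ : Subgroup (G × Perm (Fin n))),
    IsWeakHomotopyEquiv
      (classifyingMap (FixedCategory.map (φ.app n) (φ.app_act n) Γ)).hom

/-- The `n`-th space of the operad of classifying spaces, with its action of `G × Σₙ`. -/
def Space (O : GCatOperad.{u, v, w} G) (n : ℕ) : Type (max v w) := classifyingSpace (O.C n)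

instance (O : GCatOperad.{u, v, w} G) (n : ℕ) : TopologicalSpace (O.Space n) :=
  inferInstanceAs (TopologicalSpace (classifyingSpace (O.C n)))

instance (O : GCatOperad.{u, v, w} G) (n : ℕ) : MulAction (G × Perm (Fin n)) (O.Space n) where
  smul γ x := classifyingMap (O.act n γ) x
  one_smul x := by
    change classifyingMap (O.act n 1) x = x
    rw [act_one, classifyingMap_id]; rfl
  mul_smul γ δ x := by
    change classifyingMap (O.act n (γ * δ)) x =
      classifyingMap (O.act n γ) (classifyingMap (O.act n δ) x)
    rw [act_mul, classifyingMap_comp]; rfl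

/-- `O` is an `N_∞` operad (through its classifying spaces) with the families `F n` of subgroups
of `G × Σₙ`. The group `Σ₀` is trivial, so the first field says that the space
of arity `0` is `G`-contractible. -/
structure IsNInftyWith (O : GCatOperad.{u, v, w} G)
    (F : ∀ n, Set (Subgroup (G × Perm (Fin n)))) : Prop where
  contractible_zero : IsEquivariantlyContractible (G × Perm (Fin 0)) (O.Space 0)
  free : ∀ (n : ℕ) (σ : Perm (Fin n)) (x : O.Space n), ((1, σ) : G × Perm (Fin n)) • x = x → σ = 1
  family : ∀ n, IsFamilyOfSubgroups (F n)
  universal : ∀ n, IsUniversalSpace (G × Perm (Fin n)) (F n) (O.Space n)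
  prod_bot_mem : ∀ (n : ℕ) (H : Subgroup G), H.prod ⊥ ∈ F n

/-- `N_∞` operads in `G`-categories. -/
def IsNInfty (O : GCatOperad.{u, v, w} G) : Prop := ∃ F, O.IsNInftyWith F

/-- Genuine `E_∞` operads in `G`-categories: the `N_∞` operads that contain all norms, which means
that the graph of the permutation representation of each finite (ordered) `H`-set, `H ≤ G`,
belongs to the family in its arity. -/
def IsGenuineEInfty (O : GCatOperad.{u, v, w} G) : Prop :=
  ∃ F, O.IsNInftyWith F ∧
    ∀ (n : ℕ) (H : Subgroup G) (φ : H →* Perm (Fin n)), graphSubgroup H φ ∈ F n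

end GCatOperad

/-! ### The `G`-Barratt–Eccles operad and its complete suboperads -/

/-- The categorical `G`-Barratt–Eccles operad. -/
def barrattEccles (G : Type u) [Group G] : GCatOperad.{u, u, 0} G :=
  (barrattEcclesObj G).chaotic

/-- The complete suboperad relative to `𝔒`: the chaotic operad on `completeSuboperadObj G 𝔒`. -/
def completeSuboperad (G : Type u) [Group G] (𝔒 : Set (OrderedGSet.{u, v} G)) :
    GCatOperad.{u, u, 0} G :=
  (completeSuboperadObj G 𝔒).toOperad.chaotic

/-- The inclusion of the complete suboperad into the `G`-Barratt–Eccles operad. -/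
def completeSuboperadIncl (G : Type u) [Group G] (𝔒 : Set (OrderedGSet.{u, v} G)) :
    GCatOperad.Hom (completeSuboperad G 𝔒) (barrattEccles G) :=
  (completeSuboperadObj G 𝔒).incl.chaotic

end

noncomputable section

/-! ### Families of orders that are represented by operations -/

/-! An operation `p` of `P_G(n)` amounts to a family of total orders on `Fin n` indexed by `x : G`:
compare `i` and `j` through `p x i < p x j`. In these terms operadic composition is the
lexicographic sum of families, the `Σₙ`-action is reindexing, and substituting the nullary operation
deletes indices. The norm of an ordered `G`-set is the family `x • i < x • j`.

Consequently the complete suboperad contains, for every finite `G`-set `X`, a norm of `X` for some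
order: orbits are available by completeness, and the product glues them lexicographically. It is
also closed under restriction of a family to a subset of its indices, even one that is not
`G`-stable.

The decisive step is `exists_mem_of_fixed`. The pair `(g, σ)` fixes `p` exactly when `p (x * g) = p
x * σ` for all `x`. The injection `i ↦ (x ↦ p x i)` of `Fin n` into the `G`-set of functions `G →
Fin n` turns each such `σ` into translation by `g`. Restricting a norm of this `G`-set along the
injection gives an operation `q` of the suboperad with `q (x * g) = q x * σ` for every such pair. So
a subgroup of `G × Σₙ` has a fixed point in the suboperad as soon as it has one in `P_G(n)`.

The rest is formal, because a chaotic category is determined up to homotopy by whether it is empty.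
A fixed object is the apex of an equivariant cone that contracts the classifying space. Conversely,
the first vertex of a point is equivariant, so a fixed point yields a fixed object; this gives
emptiness for the other subgroups as well as freeness. Fixed point categories are again chaotic, so
the inclusion compares two contractible or two empty spaces. Finite generation holds because the
generators have bounded arity and `P_G(n)` is finite. -/

theorem perm_eq_of_lt_iff {n : ℕ} {α β : Perm (Fin n)}
    (h : ∀ i j, α i < α j ↔ β i < β j) : α = β := by
  -- The hypothesis makes `β ∘ α⁻¹` an order automorphism of `Fin n`, and the identity is the only
  -- one.
  let e : Fin n ≃o Fin n := OrderIso.ofRelIsoLT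
    { toEquiv := α.symm.trans β
      map_rel_iff' := fun {i j} => by
        have := h (α.symm i) (α.symm j)
        simpa using this.symm }
  have he : e = OrderIso.refl _ := Subsingleton.elim _ _
  ext i
  have := DFunLike.congr_fun he (α i)
  have h2 : e (α i) = β i := congr_arg β (α.symm_apply_apply i)
  rw [← h2, this]
  rfl

namespace GSetOperad.Suboperad

variable {G : Type u} [Group G] (N : (barrattEcclesObj G).Suboperad)

/-- A family of relations on `ι`, indexed by `G`, is represented by `N` if it consists of the
orders of the values of an operation of `N`, for some enumeration of `ι`. -/
def Represents {ι : Type*} (r : G → ι → ι → Prop) : Prop :=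
  ∃ (n : ℕ) (e : ι ≃ Fin n) (f : G → Perm (Fin n)), f ∈ N.carrier n ∧
    ∀ x i j, f x (e i) < f x (e j) ↔ r x i j

variable {N}

theorem Represents.congr {ι κ : Type*} {r : G → ι → ι → Prop} {s : G → κ → κ → Prop}
    (h : N.Represents r) (e : κ ≃ ι) (hs : ∀ x a b, r x (e a) (e b) ↔ s x a b) :
    N.Represents s := by
  obtain ⟨n, e', f, hf, hr⟩ := h
  exact ⟨n, e.trans e', f, hf, fun x a b => (hr x _ _).trans (hs x a b)⟩

/-- Closure under the right `Σₙ`-action absorbs the enumeration. -/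
theorem Represents.exists_mem {n : ℕ} {r : G → Fin n → Fin n → Prop}
    (h : N.Represents r) :
    ∃ f : G → Perm (Fin n), f ∈ N.carrier n ∧ ∀ x i j, f x i < f x j ↔ r x i j := by
  obtain ⟨m, e, f, hf, hr⟩ := h
  obtain rfl : n = m := by simpa using Fintype.card_congr e
  exact ⟨fun x => f x * e, N.sact_mem e hf, hr⟩

/-- By `permutedBlockSum_lt_iff`, composing operations takes the lexicographic sum of their orders.
-/
theorem Represents.sigma {ι : Type*} {κ : ι → Type*} {r : G → ι → ι → Prop}
    {s : ∀ i, G → κ i → κ i → Prop} (hr : N.Represents r) (hs : ∀ i, N.Represents (s i)) :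
    N.Represents (fun x => Sigma.Lex (r x) (fun i => s i x)) := by
  obtain ⟨n, e, f, hf, hr⟩ := hr
  choose k e' h hh hs using fun a => hs (e.symm a)
  refine ⟨∑ a, k a, (Equiv.sigmaCongrLeft e.symm).symm.trans
    ((Equiv.sigmaCongrRight e').trans finSigmaFinEquiv), fun x => permutedBlockSum (f x)
      (fun a => h a x), N.comp_mem hf hh, fun x p q => ?_⟩
  obtain ⟨⟨a, c⟩, rfl⟩ := (Equiv.sigmaCongrLeft e.symm).surjective p
  obtain ⟨⟨b, d⟩, rfl⟩ := (Equiv.sigmaCongrLeft e.symm).surjective q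
  simp only [Equiv.trans_apply, Equiv.symm_apply_apply]
  refine (permutedBlockSum_lt_iff _ _ _ _ _ _).trans ?_
  have hab : f x a < f x b ↔ r x (e.symm a) (e.symm b) := by
    simpa using hr x (e.symm a) (e.symm b)
  rw [hab, Sigma.lex_iff]
  refine or_congr Iff.rfl ⟨?_, ?_⟩
  · rintro ⟨rfl, hcd⟩
    exact ⟨rfl, (hs a x c d).1 hcd⟩
  · rintro ⟨h1, h2⟩
    obtain rfl : a = b := e.symm.injective h1
    exact ⟨rfl, (hs a x c d).2 h2⟩

theorem represents_of_subsingleton {ι : Type*} [Subsingleton ι]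
    (h0 : (N.carrier 0).Nonempty) : N.Represents (fun (_ : G) (_ _ : ι) => False) := by
  rcases isEmpty_or_nonempty ι with h | ⟨⟨i⟩⟩
  · obtain ⟨f, hf⟩ := h0
    exact ⟨0, Equiv.equivOfIsEmpty _ _, f, hf, fun _ i => isEmptyElim i⟩
  · have : Unique ι := ⟨⟨i⟩, fun j => Subsingleton.elim _ _⟩
    exact ⟨1, Equiv.ofUnique _ _, fun _ => 1, N.one_mem, fun x i j => by
      simp⟩

/-- The fibres of an injection are empty or singletons, so the restricted family is a lexicographic
sum over `ι`: the nullary operation is substituted at the indices outside the range and the unit at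
the others. -/
theorem Represents.comap {ι κ : Type*} {r : G → ι → ι → Prop} (hr : N.Represents r)
    (h0 : (N.carrier 0).Nonempty) {s : κ → ι} (hs : Function.Injective s) :
    N.Represents (fun x a b => r x (s a) (s b)) := by
  have (i : ι) : Subsingleton {a // s a = i} :=
    ⟨fun a b => Subtype.ext (hs (a.2.trans b.2.symm))⟩
  refine (hr.sigma (κ := fun i => {a // s a = i})
    (fun i => represents_of_subsingleton h0)).congr (Equiv.sigmaFiberEquiv s).symm ?_
  intro x a b
  rw [Sigma.lex_iff]
  simp [Equiv.sigmaFiberEquiv]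

theorem represents_lt_fin (h0 : (N.carrier 0).Nonempty)
    (h2 : N.Represents (fun (_ : G) (i j : Fin 2) => i < j)) (n : ℕ) :
    N.Represents (fun (_ : G) (i j : Fin n) => i < j) := by
  induction n with
  | zero => exact (represents_of_subsingleton h0).congr (Equiv.refl _) (fun _ i => i.elim0)
  | succ n ih =>
    cases n with
    | zero =>
      exact (represents_of_subsingleton (ι := Fin 1) h0).congr (Equiv.refl _)
        (fun _ i j => by
          simp [show i = j from Subsingleton.elim (α := Fin 1) i j])
    | succ n =>
      -- Of two consecutive blocks of size `n + 1`, only the first element of the first block and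
      -- the whole second block are kept.
      let s : Fin (n + 2) → Σ _ : Fin 2, Fin (n + 1) := Fin.cases ⟨0, 0⟩ (fun i => ⟨1, i⟩)
      have hs : Function.Injective s := by
        intro i j
        refine Fin.cases ?_ (fun i => ?_) i <;> refine Fin.cases ?_ (fun j => ?_) j <;>
          simp [s]
      refine ((h2.sigma (fun _ => ih)).comap h0 hs).congr (Equiv.refl _) (fun _ i j => ?_)
      rw [Sigma.lex_iff]
      refine Fin.cases ?_ (fun i => ?_) i <;> refine Fin.cases ?_ (fun j => ?_) j <;>
          simp [s]

/-- `N` orders the `G`-set `X` if it contains the norm of `X` for some order on `X`. -/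
def Orders (N : (barrattEcclesObj G).Suboperad) (X : Type*) [MulAction G X] : Prop :=
  ∃ L : X → X → Prop, N.Represents (fun x i j => L (x • i) (x • j))

theorem Orders.of_bijective {X Y : Type*} [MulAction G X] [MulAction G Y] (h : N.Orders X)
    (f : X →[G] Y) (hf : Function.Bijective f) : N.Orders Y := by
  obtain ⟨L, hL⟩ := h
  let e := (Equiv.ofBijective f hf).symm
  have he : ∀ (x : G) (i : Y), e (x • i) = x • e i := fun x i => by
    rw [Equiv.symm_apply_eq]
    change x • i = f (x • e i)
    rw [map_smul]
    exact congr_arg _ ((Equiv.ofBijective f hf).apply_symm_apply i).symm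
  exact ⟨fun i j => L (e i) (e j), hL.congr e fun x a b => by simp only [he]⟩

/-- Enumerate the orbits and order `X` lexicographically. Since the action preserves each orbit, the
comparison between different orbits does not depend on `x`, so a norm for trivial actions suffices
for the outer order. -/
theorem orders_of_orbits {X : Type*} [MulAction G X] [Finite X] (h0 : (N.carrier 0).Nonempty)
    (h2 : N.Represents (fun (_ : G) (i j : Fin 2) => i < j))
    (h : ∀ ω : MulAction.orbitRel.Quotient G X, N.Orders ω.orbit) : N.Orders X := by
  choose L hL using h
  obtain ⟨n, ⟨e⟩⟩ := Finite.exists_equiv_fin (MulAction.orbitRel.Quotient G X)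
  have hQ : N.Represents (fun (_ : G) (i j : MulAction.orbitRel.Quotient G X) => e i < e j) :=
    (represents_lt_fin h0 h2 n).congr e (fun _ _ _ => Iff.rfl)
  let E := MulAction.selfEquivSigmaOrbits' G X
  have hE : ∀ (ω : MulAction.orbitRel.Quotient G X) (p : ω.orbit) (x : G),
      E (x • (p : X)) = ⟨ω, x • p⟩ := fun ω p x => by
    rw [← Equiv.eq_symm_apply]
    rfl
  refine ⟨fun i j => Sigma.Lex (fun i j => e i < e j) L (E i) (E j), (hQ.sigma hL).congr E ?_⟩
  intro x a b
  obtain ⟨⟨ω, p⟩, rfl⟩ := E.symm.surjective a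
  obtain ⟨⟨ω', q⟩, rfl⟩ := E.symm.surjective b
  rw [Equiv.apply_symm_apply, Equiv.apply_symm_apply]
  change _ ↔ Sigma.Lex _ L (E (x • (p : X))) (E (x • (q : X)))
  rw [hE, hE, Sigma.lex_iff, Sigma.lex_iff]
  refine or_congr Iff.rfl ⟨?_, ?_⟩
  · rintro ⟨h, h'⟩
    dsimp only at h
    subst h
    exact ⟨rfl, h'⟩
  · rintro ⟨h, h'⟩
    dsimp only at h
    subst h
    exact ⟨rfl, h'⟩

end GSetOperad.Suboperad

/-! ### Norms in the complete suboperad -/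

open GSetOperad GSetOperad.Suboperad

theorem GSetOperad.generated_toOperad_eq_univ {G : Type u} [Group G] {O : GSetOperad.{u, w} G}
    (S : ∀ n, Set (O.Op n))
    (n : ℕ) : ((O.generated S).toOperad.generated (fun m => {f | f.1 ∈ S m})).carrier n =
      Set.univ := by
  refine Set.eq_univ_of_forall fun f M hM => ?_
  -- The image of `M` in `O` is a suboperad containing `S`, hence contains everything that `S`
  -- generates.
  let M' : O.Suboperad :=
    { carrier := fun m => {x | ∃ h : x ∈ (O.generated S).carrier m,
        (⟨x, h⟩ : (O.generated S).toOperad.Op m) ∈ M.carrier m}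
      one_mem := ⟨_, M.one_mem⟩
      sact_mem := fun σ ⟨_, h⟩ => ⟨_, M.sact_mem σ h⟩
      gact_mem := fun g ⟨_, h⟩ => ⟨_, M.gact_mem g h⟩
      comp_mem := fun ⟨_, h⟩ h' => ⟨_, M.comp_mem h fun i => (h' i).choose_spec⟩ }
  obtain ⟨_, h⟩ := f.2 M' fun m x hx => ⟨fun N hN => hN m hx, hM m hx⟩
  exact h

theorem norm_mem {G : Type u} [Group G] {𝔒 : Set (OrderedGSet.{u, v} G)}
    (T : OrderedGSet.{u, v} G)
    (hT : T ∈ 𝔒 ∪ {OrderedGSet.trivial G 0, OrderedGSet.trivial G 2}) :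
    T.norm ∈ (completeSuboperadObj G 𝔒).carrier T.card :=
  fun _ hN => hN _ (NormGenerator.norm T hT)

theorem represents_norm {G : Type u} [Group G] {𝔒 : Set (OrderedGSet.{u, v} G)}
    (T : OrderedGSet.{u, v} G)
    (hT : T ∈ 𝔒 ∪ {OrderedGSet.trivial G 0, OrderedGSet.trivial G 2}) :
    (completeSuboperadObj G 𝔒).Represents
      (fun x (i j : T.carrier) => x • i < x • j) := by
  let φ := monoEquivOfFin T.carrier rfl
  let f : G → Perm (Fin T.card) := T.norm
  refine ⟨_, φ.symm.toEquiv, f, norm_mem T hT, fun x i j => ?_⟩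
  have h : ∀ i, f x (φ.symm i) = φ.symm (x • i) := fun i =>
    congr_arg (fun a => φ.symm (x • a)) (φ.apply_symm_apply i)
  change f x (φ.symm i) < f x (φ.symm j) ↔ _
  rw [h, h]
  exact φ.symm.lt_iff_lt

theorem OrderedGSet.card_trivial (G : Type u) [Group G] (n : ℕ) :
    (OrderedGSet.trivial.{u, v} G n).card = n :=
  (Fintype.card_congr Equiv.ulift).trans (Fintype.card_fin n)

section

variable {G : Type u} [Group G] {𝔒 : Set (OrderedGSet.{u, v} G)}

theorem carrier_zero_nonempty (𝔒 : Set (OrderedGSet.{u, v} G)) :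
    ((completeSuboperadObj G 𝔒).carrier 0).Nonempty :=
  OrderedGSet.card_trivial.{u, v} G 0 ▸ ⟨_, norm_mem (OrderedGSet.trivial G 0) (by simp)⟩

theorem represents_two (𝔒 : Set (OrderedGSet.{u, v} G)) :
    (completeSuboperadObj G 𝔒).Represents (fun (_ : G) (i j : Fin 2) => i < j) :=
  (represents_norm (OrderedGSet.trivial G 2) (by simp)).congr
    (Equiv.ulift.symm : Fin 2 ≃ ULift.{v} (Fin 2)) (fun _ _ _ => Iff.rfl)

/-- Completeness supplies only non-trivial orbits, so a one-point orbit uses the unit of the operad.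
It also concerns only types in `Type v`, so the action on `X` is first transported to a copy of `Fin
n` there. -/
theorem orders_of_isPretransitive (h𝔒 : IsCompleteSetOfOrbits 𝔒) (X : Type w) [Finite X]
    [MulAction G X] [MulAction.IsPretransitive G X] : (completeSuboperadObj G 𝔒).Orders X := by
  rcases subsingleton_or_nontrivial X with h | h
  · exact ⟨fun _ _ => False, represents_of_subsingleton (carrier_zero_nonempty 𝔒)⟩
  · obtain ⟨n, ⟨e⟩⟩ := Finite.exists_equiv_fin X
    let e' : ULift.{v} (Fin n) ≃ X := Equiv.ulift.trans e.symm
    let : MulAction G (ULift.{v} (Fin n)) :=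
      { smul := fun g x => e'.symm (g • e' x)
        one_smul := fun x => by
          change e'.symm ((1 : G) • e' x) = x
          simp
        mul_smul := fun g h x => by
          change e'.symm ((g * h) • e' x) = e'.symm (g • e' (e'.symm (h • e' x)))
          simp [mul_smul] }
    have hsmul : ∀ (g : G) x, e' (g • x) = g • e' x := fun g x => e'.apply_symm_apply _
    have : MulAction.IsPretransitive G (ULift.{v} (Fin n)) := ⟨fun x y => by
      obtain ⟨g, hg⟩ := MulAction.exists_smul_eq G (e' x) (e' y)
      exact ⟨g, e'.injective (by rw [hsmul, hg])⟩⟩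
    have : Nontrivial (ULift.{v} (Fin n)) := e'.nontrivial
    obtain ⟨T, ⟨hT, f, hf⟩, -⟩ := h𝔒.existsUnique (ULift.{v} (Fin n))
    have hT' : (completeSuboperadObj G 𝔒).Orders T.carrier :=
      ⟨fun i j => i < j, represents_norm T (Or.inl hT)⟩
    exact (hT'.of_bijective f hf).of_bijective ⟨e', hsmul⟩ e'.bijective

theorem orders_of_finite (h𝔒 : IsCompleteSetOfOrbits 𝔒) (X : Type w) [Finite X]
    [MulAction G X] : (completeSuboperadObj G 𝔒).Orders X :=
  orders_of_orbits (carrier_zero_nonempty 𝔒) (represents_two 𝔒)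
    (fun ω => orders_of_isPretransitive h𝔒 ω.orbit)

/-- The `G`-set of functions from `G` to `Fin n`, with action by right translation. -/
def TranslationSet (G : Type u) (n : ℕ) : Type u := G → Fin n

instance (n : ℕ) : MulAction G (TranslationSet G n) where
  smul g F := fun x => F (x * g)
  one_smul F := funext fun x => congr_arg F (mul_one x)
  mul_smul g h F := funext fun x => congr_arg F (mul_assoc x g h).symm

variable [Finite G]

instance (n : ℕ) : Finite (TranslationSet G n) := inferInstanceAs (Finite (G → Fin n))

/-- The elements of `P_G(n)` that are fixed by `(g, σ)` are characterized by
`p (x * g) = p x * σ`. The complete suboperad contains an element with at least the same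
stabilizer as any given one. -/
theorem exists_mem_of_fixed (h𝔒 : IsCompleteSetOfOrbits 𝔒) {n : ℕ} (p : G → Perm (Fin n)) :
    ∃ q : G → Perm (Fin n), q ∈ (completeSuboperadObj G 𝔒).carrier n ∧
      ∀ (g : G) (σ : Perm (Fin n)), (∀ x, p (x * g) = p x * σ) → ∀ x, q (x * g) = q x * σ := by
  obtain ⟨L, hL⟩ := orders_of_finite h𝔒 (TranslationSet G n)
  -- Evaluation at the single element `1` already separates the functions `s i`. If `(g, σ)` fixes
  -- `p`, then `g • s i = s (σ i)`, so an order pulled back from the `G`-set sees `g` as `σ`.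
  let s : Fin n → TranslationSet G n := fun i x => p x i
  have hs : Function.Injective s := fun i j h => (p 1).injective (congr_fun h 1)
  obtain ⟨q, hq, hqL⟩ := (hL.comap (carrier_zero_nonempty 𝔒) hs).exists_mem
  refine ⟨q, hq, fun g σ h x => perm_eq_of_lt_iff fun i j => ?_⟩
  have hσ : ∀ i, g • s i = s (σ i) := fun i => funext fun y =>
    congr_arg (fun π : Perm (Fin n) => π i) (h y)
  rw [hqL, mul_smul, mul_smul, hσ, hσ, Perm.mul_apply, Perm.mul_apply, hqL]

/-! ### Finite generation -/

theorem card_le_of_transitive (T : OrderedGSet.{u, v} G) (h : Nonempty T.carrier)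
    (h' : MulAction.IsPretransitive G T.carrier) : T.card ≤ Nat.card G := by
  obtain ⟨t⟩ := h
  rw [OrderedGSet.card, ← Nat.card_eq_fintype_card]
  exact Nat.card_le_card_of_surjective (fun g : G => g • t) (MulAction.surjective_smul G t)

theorem arity_le_of_normGenerator (h𝔒 : IsCompleteSetOfOrbits 𝔒) {n : ℕ}
    {f : (barrattEcclesObj G).Op n} (hf : f ∈ NormGenerator 𝔒 n) : n ≤ max (Nat.card G) 2 := by
  obtain ⟨T, hT | rfl | rfl⟩ := hf
  · exact (card_le_of_transitive T (h𝔒.transitive T hT).1 (h𝔒.transitive T hT).2).trans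
      (le_max_left _ _)
  · simp [OrderedGSet.card_trivial]
  · simp [OrderedGSet.card_trivial]

theorem isFinitelyGenerated_completeSuboperadObj (h𝔒 : IsCompleteSetOfOrbits 𝔒) :
    (completeSuboperadObj G 𝔒).toOperad.IsFinitelyGenerated := by
  refine ⟨fun m => {f | f.1 ∈ NormGenerator 𝔒 m}, ?_, generated_toOperad_eq_univ _⟩
  let B := max (Nat.card G) 2
  -- Operations are counted rather than orbits: `𝔒` may contain infinitely many one-point sets, but
  -- functions `G → Σₙ` with `n ≤ B` are finite in number.
  let j : (Σ n, ({f | f.1 ∈ NormGenerator 𝔒 n} :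
      Set ((completeSuboperadObj G 𝔒).toOperad.Op n))) →
      Σ n : Fin (B + 1), G → Perm (Fin n) :=
    fun f => ⟨⟨f.1, Nat.lt_succ_of_le (arity_le_of_normGenerator h𝔒 f.2.2)⟩, f.2.1.1⟩
  refine Finite.of_injective j ?_
  rintro ⟨n, f⟩ ⟨m, g⟩ h
  obtain ⟨h1, h2⟩ := Sigma.mk.inj h
  obtain rfl : n = m := congr_arg Fin.val h1
  have : f = g := Subtype.ext (Subtype.ext (eq_of_heq h2))
  rw [this]

end

end

noncomputable section

open Opposite Simplicial

/-! ### Points of geometric realizations -/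

/-- The characteristic map of a simplex of a simplicial set. -/
def charMap (S : SSet.{u}) {n : SimplexCategory} (σ : S.obj (op n)) :
    C(stdSimplex ℝ (Fin (n.len + 1)), SSet.toTop.obj S) :=
  (SSet.toTop.obj S).toSSetObjEquiv (op n) ((sSetTopAdj.unit.app S).app (op n) σ)

theorem toSSetObjEquiv_app_map {S : SSet.{u}} {X : TopCat.{u}} (φ : S ⟶ TopCat.toSSet.obj X)
    {m n : SimplexCategory} (θ : m ⟶ n) (σ : S.obj (op n))
    (t : stdSimplex ℝ (Fin (m.len + 1))) :
    X.toSSetObjEquiv (op m) (φ.app (op m) (S.map θ.op σ)) t =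
      X.toSSetObjEquiv (op n) (φ.app (op n) σ) (stdSimplex.map θ t) := by
  have h : φ.app (op m) (S.map θ.op σ) = (TopCat.toSSet.obj X).map θ.op (φ.app (op n) σ) :=
    ConcreteCategory.congr_hom (φ.naturality θ.op) σ
  rw [h]
  exact TopCat.toSSetObjEquiv_naturality_apply θ _ t

theorem charMap_map (S : SSet.{u}) {m n : SimplexCategory} (θ : m ⟶ n) (σ : S.obj (op n))
    (t : stdSimplex ℝ (Fin (m.len + 1))) :
    charMap S (S.map θ.op σ) t = charMap S σ (stdSimplex.map θ t) :=
  toSSetObjEquiv_app_map (X := SSet.toTop.obj S) (sSetTopAdj.unit.app S) θ σ t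

theorem toTop_map_charMap {S T : SSet.{u}} (φ : S ⟶ T) {n : SimplexCategory} (σ : S.obj (op n))
    (t : stdSimplex ℝ (Fin (n.len + 1))) :
    SSet.toTop.map φ (charMap S σ t) = charMap T (φ.app (op n) σ) t := by
  have h := congr_arg (fun f => f.app (op n) σ) (sSetTopAdj.unit.naturality φ)
  have h' : (sSetTopAdj.unit.app T).app (op n) (φ.app (op n) σ) =
    (TopCat.toSSet.map (SSet.toTop.map φ)).app (op n) ((sSetTopAdj.unit.app S).app (op n) σ) := h
  rw [charMap, charMap, h']
  rfl

/-- The morphism to a singular simplicial set that is given by a compatible family of maps. -/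
def toSingular (S : SSet.{u}) (X : TopCat.{u})
    (g : ∀ n : SimplexCategory, S.obj (op n) → C(stdSimplex ℝ (Fin (n.len + 1)), X))
    (hg : ∀ (m n : SimplexCategory) (θ : m ⟶ n) (σ : S.obj (op n))
      (t : stdSimplex ℝ (Fin (m.len + 1))),
      g m (S.map θ.op σ) t = g n σ (stdSimplex.map θ t)) : S ⟶ TopCat.toSSet.obj X where
  app n := ↾fun σ => (X.toSSetObjEquiv n).symm (g n.unop σ)
  naturality n m θ := by
    ext σ
    refine (X.toSSetObjEquiv m).injective ?_
    ext t
    exact hg m.unop n.unop θ.unop σ t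

/-- A compatible family is a simplicial map to the singular set of `X`; its transpose under the
adjunction is the required map. -/
theorem exists_map_of_charMap (S : SSet.{u}) (X : Type u) [TopologicalSpace X]
    (g : ∀ n : SimplexCategory, S.obj (op n) → C(stdSimplex ℝ (Fin (n.len + 1)), X))
    (hg : ∀ (m n : SimplexCategory) (θ : m ⟶ n) (σ : S.obj (op n))
      (t : stdSimplex ℝ (Fin (m.len + 1))),
      g m (S.map θ.op σ) t = g n σ (stdSimplex.map θ t)) :
    ∃ f : C(SSet.toTop.obj S, X), ∀ (n : SimplexCategory) (σ : S.obj (op n))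
      (t : stdSimplex ℝ (Fin (n.len + 1))), f (charMap S σ t) = g n σ t := by
  let φ := toSingular S (TopCat.of X) g hg
  refine ⟨((sSetTopAdj.homEquiv S (TopCat.of X)).symm φ).hom, fun n σ t => ?_⟩
  have h := (sSetTopAdj.homEquiv S (TopCat.of X)).apply_symm_apply φ
  rw [Adjunction.homEquiv_unit] at h
  have h' := congr_arg (fun f => (TopCat.of X).toSSetObjEquiv (op n) (f.app (op n) σ) t) h
  exact h'

theorem hom_ext_charMap {S : SSet.{u}} {X : Type u} [TopologicalSpace X]
    {f g : C(SSet.toTop.obj S, X)}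
    (h : ∀ (n : SimplexCategory) (σ : S.obj (op n)) (t : stdSimplex ℝ (Fin (n.len + 1))),
      f (charMap S σ t) = g (charMap S σ t)) : f = g := by
  have : TopCat.ofHom f = (TopCat.ofHom g : SSet.toTop.obj S ⟶ TopCat.of X) := by
    refine (sSetTopAdj.homEquiv S (TopCat.of X)).injective ?_
    rw [Adjunction.homEquiv_unit, Adjunction.homEquiv_unit]
    ext n σ
    refine ((TopCat.of X).toSSetObjEquiv n).injective ?_
    ext t
    exact h n.unop σ t
  exact congr_arg TopCat.Hom.hom this

theorem exists_charMap_eq (S : SSet.{u}) (x : SSet.toTop.obj S) :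
    ∃ (n : SimplexCategory) (σ : S.obj (op n)) (t : stdSimplex ℝ (Fin (n.len + 1))),
      charMap S σ t = x := by
  -- With the indiscrete topology every predicate is continuous. "Lies in the image of a
  -- characteristic map" and "true" agree on all simplices, hence everywhere.
  let : TopologicalSpace (ULift.{u} Prop) := ⊤
  let p : SSet.toTop.obj S → ULift.{u} Prop := fun x => ⟨∃ (n : SimplexCategory) (σ : S.obj (op n))
    (t : stdSimplex ℝ (Fin (n.len + 1))), charMap S σ t = x⟩
  have h : (⟨p, continuous_top⟩ : C(SSet.toTop.obj S, ULift.{u} Prop)) =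
      ⟨fun _ => ⟨True⟩, continuous_top⟩ :=
    hom_ext_charMap fun n σ t => ULift.ext _ _ (eq_true ⟨n, σ, t, rfl⟩)
  exact of_eq_true (congr_arg ULift.down (DFunLike.congr_fun h x))

/-! ### The first vertex of a point -/

/-- The first vertex of the face of the standard simplex that contains `t` in its interior. -/
def firstVertex {n : ℕ} (t : stdSimplex ℝ (Fin (n + 1))) : Fin (n + 1) :=
  sInf {i | 0 < t i}

theorem firstVertex_mem {n : ℕ} (t : stdSimplex ℝ (Fin (n + 1))) : 0 < t (firstVertex t) := by
  refine csInf_mem (s := {i | 0 < t i}) ?_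
  by_contra h
  have h0 : ∀ i, t i = 0 := fun i =>
    le_antisymm (not_lt.1 fun hi => h ⟨i, hi⟩) (stdSimplex.zero_le t i)
  have := stdSimplex.sum_eq_one t
  simp [h0] at this

theorem firstVertex_le {n : ℕ} (t : stdSimplex ℝ (Fin (n + 1))) {i : Fin (n + 1)} (hi : 0 < t i) :
    firstVertex t ≤ i := csInf_le (OrderBot.bddBelow _) hi

/-- The support of the pushforward is the image of the support, and a monotone map preserves minima.
This makes the first vertex well defined on the realization. -/
theorem firstVertex_map {m n : ℕ} (θ : Fin (m + 1) →o Fin (n + 1))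
    (t : stdSimplex ℝ (Fin (m + 1))) : firstVertex (stdSimplex.map θ t) = θ (firstVertex t) := by
  classical
  have hval : ∀ i, stdSimplex.map θ t i = ∑ j with θ j = i, t j := fun i => by
    rw [stdSimplex.map_coe, FunOnFinite.linearMap_apply_apply]
  refine le_antisymm (firstVertex_le _ ?_) ?_
  · rw [hval]
    exact Finset.sum_pos' (fun j _ => stdSimplex.zero_le t j)
      ⟨firstVertex t, by simp, firstVertex_mem t⟩
  · have h := firstVertex_mem (stdSimplex.map θ t)
    rw [hval] at h
    obtain ⟨j, hj, hjt⟩ := Finset.exists_lt_of_sum_lt (f := fun _ => (0 : ℝ)) (by simpa using h)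
    rw [← (Finset.mem_filter.1 hj).2]
    exact θ.monotone (firstVertex_le t hjt)

/-- The characteristic map of a simplex of the nerve of a category. -/
def nerveCharMap {C : Type u} [Category.{0} C] {n : SimplexCategory}
    (σ : ComposableArrows C n.len) : C(stdSimplex ℝ (Fin (n.len + 1)), classifyingSpace C) :=
  charMap (nerve C) (n := n) σ

theorem nerveCharMap_whiskerLeft {C : Type u} [Category.{0} C] {m n : SimplexCategory}
    (θ : m ⟶ n) (σ : ComposableArrows C n.len) (t : stdSimplex ℝ (Fin (m.len + 1))) :
    nerveCharMap (σ.whiskerLeft (SimplexCategory.toCat.map θ).toFunctor) t =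
      nerveCharMap σ (stdSimplex.map θ t) :=
  charMap_map (nerve C) θ σ t

theorem classifyingMap_nerveCharMap {C D : Type u} [Category.{0} C] [Category.{0} D] (F : C ⥤ D)
    {n : SimplexCategory} (σ : ComposableArrows C n.len) (t : stdSimplex ℝ (Fin (n.len + 1))) :
    classifyingMap F (nerveCharMap σ t) = nerveCharMap (σ ⋙ F) t :=
  toTop_map_charMap (nerveMap F) σ t

theorem exists_nerveCharMap_eq {C : Type u} [Category.{0} C] (x : classifyingSpace C) :
    ∃ (n : SimplexCategory) (σ : ComposableArrows C n.len)
      (t : stdSimplex ℝ (Fin (n.len + 1))), nerveCharMap σ t = x :=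
  exists_charMap_eq (nerve C) x

theorem exists_map_of_nerveCharMap (C : Type u) [Category.{0} C] (X : Type u) [TopologicalSpace X]
    (g : ∀ n : SimplexCategory, ComposableArrows C n.len → C(stdSimplex ℝ (Fin (n.len + 1)), X))
    (hg : ∀ (m n : SimplexCategory) (θ : m ⟶ n) (σ : ComposableArrows C n.len)
      (t : stdSimplex ℝ (Fin (m.len + 1))),
      g m (σ.whiskerLeft (SimplexCategory.toCat.map θ).toFunctor) t =
        g n σ (stdSimplex.map θ t)) :
    ∃ f : C(classifyingSpace C, X), ∀ (n : SimplexCategory) (σ : ComposableArrows C n.len)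
      (t : stdSimplex ℝ (Fin (n.len + 1))), f (nerveCharMap σ t) = g n σ t :=
  exists_map_of_charMap (nerve C) X g hg

theorem exists_firstVertexMap (C : Type u) [Category.{0} C] :
    ∃ v : classifyingSpace C → C, ∀ (n : SimplexCategory) (σ : ComposableArrows C n.len)
      (t : stdSimplex ℝ (Fin (n.len + 1))),
      v (nerveCharMap σ t) = σ.obj (firstVertex t) := by
  -- The first vertex is not continuous in any useful sense; the indiscrete topology makes the
  -- universal property produce a mere function.
  let : TopologicalSpace C := ⊤
  obtain ⟨f, hf⟩ := exists_map_of_nerveCharMap C C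
    (fun n σ => ⟨fun t => σ.obj (firstVertex t), continuous_top⟩)
    (fun m n θ σ t => congr_arg (fun i => σ.obj i) (firstVertex_map θ.toOrderHom t).symm)
  exact ⟨f, hf⟩

/-- The first vertex of a point of a classifying space. -/
def firstObj {C : Type u} [Category.{0} C] (x : classifyingSpace C) : C :=
  (exists_firstVertexMap C).choose x

theorem firstObj_nerveCharMap {C : Type u} [Category.{0} C] {n : SimplexCategory}
    (σ : ComposableArrows C n.len) (t : stdSimplex ℝ (Fin (n.len + 1))) :
    firstObj (nerveCharMap σ t) = σ.obj (firstVertex t) :=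
  (exists_firstVertexMap C).choose_spec n σ t

/-- This naturality turns a point fixed by a group action into a fixed object. -/
theorem firstObj_classifyingMap {C D : Type u} [Category.{0} C] [Category.{0} D] (F : C ⥤ D)
    (x : classifyingSpace C) : firstObj (classifyingMap F x) = F.obj (firstObj x) := by
  obtain ⟨n, σ, t, rfl⟩ := exists_nerveCharMap_eq x
  rw [classifyingMap_nerveCharMap, firstObj_nerveCharMap, firstObj_nerveCharMap]
  rfl

/-! ### The contraction of the classifying space of a chaotic category -/

/-- The map of cones that is induced by a map of ordinals. -/
def coneMap {m n : SimplexCategory} (θ : m ⟶ n) :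
    SimplexCategory.mk (m.len + 1) ⟶ SimplexCategory.mk (n.len + 1) :=
  SimplexCategory.Hom.mk ⟨Fin.cases 0 (fun i => (θ i).succ), fun i j => by
    refine Fin.cases (fun _ => by simp) (fun i => ?_) i
    refine Fin.cases (fun h => by simp at h) (fun j h => ?_) j
    exact Fin.succ_le_succ_iff.2 (θ.toOrderHom.monotone (Fin.succ_le_succ_iff.1 h))⟩

/-- The straight line from the cone point to a point of the base of the cone on a simplex. -/
def coneLine (n : ℕ) :
    C(stdSimplex ℝ (Fin (n + 1)) × unitInterval, stdSimplex ℝ (Fin (n + 2))) where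
  toFun p := ⟨(1 - (p.2 : ℝ)) • (stdSimplex.vertex (S := ℝ) (0 : Fin (n + 2))).1 +
      (p.2 : ℝ) • (stdSimplex.map Fin.succ p.1).1,
    convex_stdSimplex ℝ _ (stdSimplex.vertex (S := ℝ) 0).2 (stdSimplex.map Fin.succ p.1).2
      (by linarith [p.2.2.2]) p.2.2.1 (by ring)⟩
  continuous_toFun := by
    refine Continuous.subtype_mk ?_ _
    have := stdSimplex.continuous_map (S := ℝ) (Fin.succ : Fin (n + 1) → Fin (n + 2))
    fun_prop

theorem map_coneLine {m n : SimplexCategory} (θ : m ⟶ n) (t : stdSimplex ℝ (Fin (m.len + 1)))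
    (s : unitInterval) :
    stdSimplex.map (coneMap θ) (coneLine m.len (t, s)) =
      coneLine n.len (stdSimplex.map θ t, s) := by
  have h0 := congr_arg Subtype.val (stdSimplex.map_vertex (S := ℝ) (coneMap θ) 0)
  have h1 : (stdSimplex.map (coneMap θ) (stdSimplex.map (Fin.succ : _ → Fin (m.len + 2)) t)).1 =
      (stdSimplex.map (S := ℝ) (Fin.succ : _ → Fin (n.len + 2)) (stdSimplex.map θ t)).1 := by
    rw [stdSimplex.map_comp_apply, stdSimplex.map_comp_apply]
    rfl
  refine Subtype.ext ?_
  refine (((FunOnFinite.linearMap ℝ ℝ (coneMap θ)).map_add _ _).trans ?_)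
  rw [LinearMap.map_smul, LinearMap.map_smul]
  exact congr_arg₂ (fun a b => (1 - (s : ℝ)) • a + (s : ℝ) • b) h0 h1

theorem coneLine_zero (n : ℕ) (t : stdSimplex ℝ (Fin (n + 1))) :
    coneLine n (t, 0) = stdSimplex.vertex 0 := by
  refine Subtype.ext ?_
  simp [coneLine]

theorem coneLine_one (n : ℕ) (t : stdSimplex ℝ (Fin (n + 1))) :
    coneLine n (t, 1) = stdSimplex.map Fin.succ t := by
  refine Subtype.ext ?_
  simp [coneLine]

section

variable {C : Type u} [Category.{0} C] [∀ x y : C, Unique (x ⟶ y)]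

/-- The cone on a simplex of the nerve of a chaotic category. -/
def coneSimplex (x₀ : C) {n : ℕ} (σ : ComposableArrows C n) : ComposableArrows C (n + 1) where
  obj := Fin.cases x₀ σ.obj
  map _ := default
  map_id _ := Subsingleton.elim _ _
  map_comp _ _ := Subsingleton.elim _ _

theorem coneSimplex_whiskerLeft (x₀ : C) {m n : SimplexCategory} (θ : m ⟶ n)
    (σ : ComposableArrows C n.len) :
    coneSimplex x₀ (σ.whiskerLeft (SimplexCategory.toCat.map θ).toFunctor) =
      (coneSimplex x₀ σ).whiskerLeft (SimplexCategory.toCat.map (coneMap θ)).toFunctor := by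
  refine CategoryTheory.Functor.ext (fun i => ?_) (fun _ _ _ => Subsingleton.elim _ _)
  refine Fin.cases ?_ (fun i => ?_) i <;> rfl

/-- The point of the classifying space that is given by an object. -/
def objPoint {C : Type u} [Category.{0} C] (x : C) : classifyingSpace C :=
  nerveCharMap (n := SimplexCategory.mk 0) (ComposableArrows.mk₀ x) (stdSimplex.vertex 0)

theorem nerveCharMap_vertex {C : Type u} [Category.{0} C] {n : SimplexCategory}
    (σ : ComposableArrows C n.len) (i : Fin (n.len + 1)) :
    nerveCharMap σ (stdSimplex.vertex i) = objPoint (σ.obj i) := by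
  have h : ComposableArrows.mk₀ (σ.obj i) = σ.whiskerLeft
      (SimplexCategory.toCat.map (SimplexCategory.const (SimplexCategory.mk 0) n i)).toFunctor :=
    ComposableArrows.ext₀ rfl
  refine Eq.symm ((congr_arg (fun τ => nerveCharMap (n := SimplexCategory.mk 0) τ _) h).trans
    ((nerveCharMap_whiskerLeft _ σ _).trans ?_))
  exact congr_arg _ (stdSimplex.map_vertex _ _)

theorem classifyingMap_objPoint {C D : Type u} [Category.{0} C] [Category.{0} D] (F : C ⥤ D)
    (x : C) : classifyingMap F (objPoint x) = objPoint (F.obj x) :=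
  (classifyingMap_nerveCharMap F _ _).trans (nerveCharMap_vertex _ _)

/-- The universal property gives maps out of the realization, not out of its product with the
interval, so the homotopy is built in curried form with values in the path space. -/
theorem exists_coneMap (x₀ : C) :
    ∃ f : C(classifyingSpace C, C(unitInterval, classifyingSpace C)),
      ∀ (n : SimplexCategory) (σ : ComposableArrows C n.len)
        (t : stdSimplex ℝ (Fin (n.len + 1))) (s : unitInterval), f (nerveCharMap σ t) s =
          nerveCharMap (n := SimplexCategory.mk (n.len + 1)) (coneSimplex x₀ σ)
            (coneLine n.len (t, s)) := by
  obtain ⟨f, hf⟩ := exists_map_of_nerveCharMap C C(unitInterval, classifyingSpace C)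
    (fun n σ => ((nerveCharMap (n := SimplexCategory.mk (n.len + 1))
      (coneSimplex x₀ σ)).comp (coneLine n.len)).curry)
    (fun m n θ σ t => by
      ext s
      change nerveCharMap (n := SimplexCategory.mk (m.len + 1)) _ _ =
        nerveCharMap (n := SimplexCategory.mk (n.len + 1)) _ _
      rw [ContinuousMap.coe_mk, ← map_coneLine]
      exact (congr_arg (fun τ => nerveCharMap (n := SimplexCategory.mk (m.len + 1)) τ _)
        (coneSimplex_whiskerLeft x₀ θ σ)).trans (nerveCharMap_whiskerLeft _ _ _))
  exact ⟨f, fun n σ t s => DFunLike.congr_fun (hf n σ t) s⟩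

theorem exists_contraction (x₀ : C) :
    ∃ H : (ContinuousMap.id (classifyingSpace C)).Homotopy
        (ContinuousMap.const (classifyingSpace C) (objPoint x₀)),
      ∀ (F : C ⥤ C), F.obj x₀ = x₀ → ∀ (t : unitInterval) (x : classifyingSpace C),
        H (t, classifyingMap F x) = classifyingMap F (H (t, x)) := by
  obtain ⟨f, hf⟩ := exists_coneMap x₀
  -- Cone lines start at the apex; reversing time makes the homotopy start at the identity.
  refine ⟨⟨⟨fun p => f p.2 (unitInterval.symm p.1), by fun_prop⟩, fun x => ?_, fun x => ?_⟩, ?_⟩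
  · obtain ⟨n, σ, t, rfl⟩ := exists_nerveCharMap_eq x
    change f (nerveCharMap σ t) (unitInterval.symm 0) = _
    rw [hf, unitInterval.symm_zero, coneLine_one]
    let δ : n ⟶ SimplexCategory.mk (n.len + 1) :=
      SimplexCategory.Hom.mk ⟨Fin.succ, Fin.strictMono_succ.monotone⟩
    exact (nerveCharMap_whiskerLeft δ (coneSimplex x₀ σ) t).symm.trans
      (congr_arg (fun τ => nerveCharMap τ t)
        (CategoryTheory.Functor.ext (fun i => rfl) (fun _ _ _ => Subsingleton.elim _ _)))
  · obtain ⟨n, σ, t, rfl⟩ := exists_nerveCharMap_eq x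
    change f (nerveCharMap σ t) (unitInterval.symm 1) = _
    rw [hf, unitInterval.symm_one, coneLine_zero]
    exact nerveCharMap_vertex (n := SimplexCategory.mk (n.len + 1)) _ _
  · intro F hF s x
    obtain ⟨n, σ, t, rfl⟩ := exists_nerveCharMap_eq x
    change f (classifyingMap F (nerveCharMap σ t)) (unitInterval.symm s) =
      classifyingMap F (f (nerveCharMap σ t) (unitInterval.symm s))
    rw [classifyingMap_nerveCharMap, hf, hf, classifyingMap_nerveCharMap]
    -- As `F` fixes the apex and arrows are unique, the cone on `σ ⋙ F` is the cone on `σ` followed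
    -- by `F`.
    refine congr_arg (fun τ => nerveCharMap (n := SimplexCategory.mk (n.len + 1)) τ _) ?_
    refine CategoryTheory.Functor.ext (fun i => ?_) (fun _ _ _ => Subsingleton.elim _ _)
    refine Fin.cases hF.symm (fun i => rfl) i

theorem contractibleSpace_classifyingSpace (x₀ : C) : ContractibleSpace (classifyingSpace C) := by
  obtain ⟨H, _⟩ := exists_contraction x₀
  exact (contractible_iff_id_nullhomotopic _).2 ⟨_, ⟨H⟩⟩

end

theorem isEmpty_classifyingSpace (C : Type u) [Category.{0} C] [IsEmpty C] :
    IsEmpty (classifyingSpace C) := ⟨fun x => isEmptyElim (firstObj x)⟩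

/-! ### Homotopy groups of contractible spaces -/

open scoped unitInterval Topology

/-- Dilation of the unit interval about its midpoint. -/
def dilate (p : I × I) : I :=
  Set.projIcc 0 1 zero_le_one (((p.2 : ℝ) - 1 / 2) * (1 + p.1) + 1 / 2)

theorem continuous_dilate : Continuous dilate := by
  unfold dilate
  refine continuous_projIcc.comp ?_
  fun_prop

theorem dilate_zero_left (y : I) : dilate (0, y) = y := by
  simp [dilate]

theorem dilate_eq_zero {s y : I} (h : ((y : ℝ) - 1 / 2) * (1 + s) + 1 / 2 ≤ 0) :
    dilate (s, y) = 0 := Set.projIcc_of_le_left _ h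

theorem dilate_eq_one {s y : I} (h : 1 ≤ ((y : ℝ) - 1 / 2) * (1 + s) + 1 / 2) :
    dilate (s, y) = 1 := Set.projIcc_of_right_le _ h

theorem dilate_mem_boundary {n : ℕ} {y : Fin n → I} (hy : y ∈ Cube.boundary (Fin n)) (s : I) :
    (fun i => dilate (s, y i)) ∈ Cube.boundary (Fin n) := by
  obtain ⟨i, hi | hi⟩ := hy
  · refine ⟨i, Or.inl (dilate_eq_zero ?_)⟩
    rw [hi]; have := s.2.1; norm_num; linarith
  · refine ⟨i, Or.inr (dilate_eq_one ?_)⟩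
    rw [hi]; have := s.2.1; norm_num; linarith

/-- A bump function on the interval that vanishes on the boundary. -/
def bump (y : I) : I := Set.projIcc 0 1 zero_le_one (4 * min (y : ℝ) (1 - y))

theorem continuous_bump : Continuous bump := by
  unfold bump
  refine continuous_projIcc.comp ?_
  fun_prop

theorem bump_eq_one_or (y : I) : bump y = 1 ∨ dilate (1, y) = 0 ∨ dilate (1, y) = 1 := by
  by_cases h : 1 ≤ 4 * min (y : ℝ) (1 - y)
  · exact Or.inl (Set.projIcc_of_right_le _ h)
  · right
    rcases min_lt_iff.1 (show min (y : ℝ) (1 - y) < 1 / 4 by linarith) with h | h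
    · left; refine dilate_eq_zero ?_; norm_num; linarith
    · right; refine dilate_eq_one ?_; norm_num; linarith

theorem prod_bump_boundary {n : ℕ} {y : Fin n → I} (hy : y ∈ Cube.boundary (Fin n)) :
    ∏ i, bump (y i) = 0 := by
  obtain ⟨i, hi⟩ := hy
  refine Finset.prod_eq_zero (Finset.mem_univ i) ?_
  refine Set.projIcc_of_le_left _ ?_
  rcases hi with hi | hi <;> rw [hi] <;> norm_num

/-- The contraction `H` may move the base point, so it cannot be applied to a loop directly.
Dilating the cube first makes the loop constant outside the inner cube `[1/4, 3/4]ⁿ`. The product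
`u` of bumps is `1` on the inner cube and `0` on the boundary; used as the time of `H`, it contracts
the inner cube while the collar runs along the track of the base point. That track is then
withdrawn. -/
theorem subsingleton_homotopyGroup {X : Type u} [TopologicalSpace X] [ContractibleSpace X] (n : ℕ)
    (x : X) : Subsingleton (HomotopyGroup.Pi n X x) := by
  obtain ⟨x₀, ⟨H⟩⟩ := id_nullhomotopic X
  suffices h : ∀ f : GenLoop (Fin n) X x, GenLoop.Homotopic f GenLoop.const by
    refine ⟨fun a b => ?_⟩
    induction a using Quotient.inductionOn with | _ f
    induction b using Quotient.inductionOn with | _ g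
    exact Quotient.sound ((h f).trans (h g).symm)
  intro f
  let u : C(Fin n → I, I) := ⟨fun y => ∏ i, bump (y i), by
    have := continuous_bump
    fun_prop⟩
  have hu : ∀ y ∈ Cube.boundary (Fin n), u y = 0 := fun y hy => prod_bump_boundary hy
  have hd := continuous_dilate
  let f₁ : C(Fin n → I, X) := ⟨fun y => f (fun i => dilate (1, y i)), by fun_prop⟩
  let f₂ : C(Fin n → I, X) := ⟨fun y => H (u y, x), by fun_prop⟩
  have h01 : (f.1).HomotopicRel f₁ (Cube.boundary (Fin n)) :=
    ⟨⟨⟨⟨fun p => f (fun i => dilate (p.1, p.2 i)), by fun_prop⟩,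
      fun y => by simp [dilate_zero_left], fun y => rfl⟩, fun t y hy =>
        (f.2 _ (dilate_mem_boundary hy t)).trans (f.2 y hy).symm⟩⟩
  have h12 : f₁.HomotopicRel f₂ (Cube.boundary (Fin n)) := by
    refine ⟨⟨⟨⟨fun p => H (p.1 * u p.2, f₁ p.2), by fun_prop⟩, fun y => by simp, fun y => ?_⟩,
      fun t y hy => ?_⟩⟩
    · change H (1 * u y, f₁ y) = H (u y, x)
      rw [one_mul]
      -- In the inner cube `H` has reached its constant end; elsewhere the dilated loop already has
      -- value `x`.
      by_cases h : ∀ i, bump (y i) = 1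
      · have : u y = 1 := Finset.prod_eq_one (s := Finset.univ) fun i _ => h i
        rw [this, H.apply_one, H.apply_one]; rfl
      · obtain ⟨i, hi⟩ := not_forall.1 h
        have : f₁ y = x := f.2 _ ⟨i, (bump_eq_one_or (y i)).resolve_left hi⟩
        rw [this]
    · change H (t * u y, f₁ y) = f₁ y
      rw [hu y hy, mul_zero, H.apply_zero]; rfl
  have h23 : f₂.HomotopicRel (GenLoop.const (N := Fin n) (x := x)).1 (Cube.boundary (Fin n)) := by
    refine ⟨⟨⟨⟨fun p => H (unitInterval.symm p.1 * u p.2, x), by fun_prop⟩, fun y => ?_,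
      fun y => ?_⟩, fun t y hy => ?_⟩⟩
    · simp [f₂]
    · simp
    · change H (unitInterval.symm t * u y, x) = H (u y, x)
      rw [hu y hy, mul_zero]
  exact (h01.trans h12).trans h23

theorem isWeakHomotopyEquiv_of_contractible {X Y : Type u} [TopologicalSpace X]
    [TopologicalSpace Y] [ContractibleSpace X] [ContractibleSpace Y] (f : C(X, Y)) :
    IsWeakHomotopyEquiv f where
  bijective_zeroth := by
    refine ⟨fun a b _ => ?_, fun b => ?_⟩
    · induction a using Quotient.inductionOn with | _ a
      induction b using Quotient.inductionOn with | _ b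
      exact Quotient.sound (PathConnectedSpace.joined a b)
    · induction b using Quotient.inductionOn with | _ b
      obtain ⟨a⟩ := (inferInstance : Nonempty X)
      exact ⟨Quotient.mk _ a, Quotient.sound (PathConnectedSpace.joined _ b)⟩
  bijective_pi n x := by
    have := subsingleton_homotopyGroup n x
    have := subsingleton_homotopyGroup n (f x)
    exact ⟨fun a b _ => Subsingleton.elim a b, fun b =>
      ⟨Quotient.mk _ GenLoop.const, Subsingleton.elim _ b⟩⟩

theorem isWeakHomotopyEquiv_of_isEmpty {X Y : Type u} [TopologicalSpace X]
    [TopologicalSpace Y] [IsEmpty X] [IsEmpty Y] (f : C(X, Y)) :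
    IsWeakHomotopyEquiv f where
  bijective_zeroth := by
    refine ⟨fun a => ?_, fun b => ?_⟩
    · induction a using Quotient.inductionOn with | _ a
      exact isEmptyElim a
    · induction b using Quotient.inductionOn with | _ b
      exact isEmptyElim b
  bijective_pi n x := isEmptyElim x

end

noncomputable section

/-! ### Fixed points of chaotic operads -/

theorem IsEquivariantlyContractible.contractibleSpace_fixedPoints {K : Type u} [Group K]
    {X : Type v} [TopologicalSpace X] [MulAction K X] (h : IsEquivariantlyContractible K X) :
    ContractibleSpace (MulAction.fixedPoints K X) := by
  obtain ⟨x₀, hx₀, H, hH⟩ := h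
  refine (contractible_iff_id_nullhomotopic _).2 ⟨⟨x₀, hx₀⟩, ⟨⟨⟨fun p => ⟨H (p.1, p.2.1),
    fun k => ?_⟩, ?_⟩, fun x => ?_, fun x => ?_⟩⟩⟩
  · rw [← hH, p.2.2 k]
  · fun_prop
  · exact Subtype.ext (H.apply_zero x.1)
  · exact Subtype.ext (H.apply_one x.1)

section

variable {G : Type u} [Group G] (O : GSetOperad.{u, u} G)

instance (n : ℕ) (x y : O.chaotic.C n) : Unique (x ⟶ y) :=
  Codiscrete.uniqueHom (A := O.Op n) x y

instance (n : ℕ) (Γ : Subgroup (G × Perm (Fin n))) (x y : FixedCategory (O.chaotic.act n) Γ) :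
    Unique (x ⟶ y) where
  default := ⟨default, fun _ _ => Subsingleton.elim _ _⟩
  uniq _ := Subtype.ext (Subsingleton.elim _ _)

variable {O}

/-- The point that is given by an operation. -/
def opPoint {n : ℕ} (f : O.chaotic.C n) : O.chaotic.Space n := objPoint f

theorem smul_opPoint {n : ℕ} (γ : G × Perm (Fin n)) (f : O.chaotic.C n) :
    γ • opPoint f = opPoint ((O.chaotic.act n γ).obj f) :=
  classifyingMap_objPoint _ _

/-- The operation in the first vertex of a point. -/
def firstOp {n : ℕ} (x : O.chaotic.Space n) : O.chaotic.C n := firstObj x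

theorem firstOp_smul {n : ℕ} (γ : G × Perm (Fin n)) (x : O.chaotic.Space n) :
    firstOp (γ • x) = (O.chaotic.act n γ).obj (firstOp x) :=
  firstObj_classifyingMap _ _

theorem isEquivariantlyContractible_space {n : ℕ} (Γ : Subgroup (G × Perm (Fin n)))
    (f : O.chaotic.C n) (hf : ∀ γ ∈ Γ, (O.chaotic.act n γ).obj f = f) :
    IsEquivariantlyContractible Γ (O.chaotic.Space n) := by
  obtain ⟨H, hH⟩ := exists_contraction f
  refine ⟨opPoint f, fun γ => ?_, H, fun γ t x => ?_⟩
  · exact (smul_opPoint γ.1 f).trans (congr_arg opPoint (hf γ.1 γ.2))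
  · exact hH _ (hf γ.1 γ.2) t x

/-- A fixed operation gives an equivariant contraction, which restricts to fixed points; a fixed
point of the space has a fixed operation as its first vertex. -/
theorem isUniversalSpace_chaotic (n : ℕ) {F : Set (Subgroup (G × Perm (Fin n)))}
    (hF : ∀ Γ, Γ ∈ F ↔ ∃ f : O.chaotic.C n, ∀ γ ∈ Γ, (O.chaotic.act n γ).obj f = f) :
    IsUniversalSpace (G × Perm (Fin n)) F (O.chaotic.Space n) := by
  refine fun Γ => ⟨fun hΓ => ?_, fun hΓ => ⟨fun x => hΓ ((hF Γ).2 ?_)⟩⟩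
  · obtain ⟨f, hf⟩ := (hF Γ).1 hΓ
    exact (isEquivariantlyContractible_space Γ f hf).contractibleSpace_fixedPoints
  · refine ⟨firstOp x.1, fun γ hγ => ?_⟩
    rw [← firstOp_smul]
    exact congr_arg firstOp (x.2 ⟨γ, hγ⟩)

/-- A map of chaotic operads is an equivalence if it reflects the existence of fixed points. -/
theorem isEquivalence_of_fixed {N O : GSetOperad.{u, u} G}
    (φ : GCatOperad.Hom N.chaotic O.chaotic)
    (h : ∀ (n : ℕ) (Γ : Subgroup (G × Perm (Fin n))),
      Nonempty (FixedCategory (O.chaotic.act n) Γ) →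
        Nonempty (FixedCategory (N.chaotic.act n) Γ)) : φ.IsEquivalence := by
  intro n Γ
  rcases isEmpty_or_nonempty (FixedCategory (O.chaotic.act n) Γ) with hO | hO
  · have : IsEmpty (FixedCategory (N.chaotic.act n) Γ) :=
      ⟨fun x => hO.elim ((FixedCategory.map (φ.app n) (φ.app_act n) Γ).obj x)⟩
    have h1 := isEmpty_classifyingSpace (FixedCategory (N.chaotic.act n) Γ)
    have h2 := isEmpty_classifyingSpace (FixedCategory (O.chaotic.act n) Γ)
    exact isWeakHomotopyEquiv_of_isEmpty _
  · obtain ⟨y⟩ := hO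
    obtain ⟨x⟩ := h n Γ ⟨y⟩
    have h1 := contractibleSpace_classifyingSpace x
    have h2 := contractibleSpace_classifyingSpace y
    exact isWeakHomotopyEquiv_of_contractible _

end

/-! ### Subgroups with fixed points in `P_G` and in the complete suboperad -/

section

variable {G : Type u} [Group G]

/-- The subgroups of `G × Σₙ` that have a fixed point in `P_G(n)`. -/
def fixingSubgroups (G : Type u) [Group G] (n : ℕ) : Set (Subgroup (G × Perm (Fin n))) :=
  {Γ | ∃ p : G → Perm (Fin n), ∀ γ ∈ Γ, ∀ x, p (x * γ.1) = p x * γ.2}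

theorem isFamilyOfSubgroups_fixingSubgroups (n : ℕ) :
    IsFamilyOfSubgroups (fixingSubgroups G n) where
  mem_of_le := fun ⟨p, hp⟩ hle => ⟨p, fun γ hγ => hp γ (hle hγ)⟩
  conj_mem := by
    rintro Γ k ⟨p, hp⟩
    -- This is the translate `k • p`, fixed by the conjugate subgroup.
    refine ⟨fun x => p (x * k.1) * k.2⁻¹, ?_⟩
    rintro _ ⟨γ, hγ, rfl⟩ x
    have := hp γ hγ (x * k.1)
    simp [mul_assoc] at this ⊢
    rw [this, mul_assoc]

/-- Write `x = r * h` with `r` the chosen representative of the coset `xH` and set `p x = φ h`.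
Right multiplication by `H` keeps `r`, so it acts through `φ`. -/
theorem graphSubgroup_mem_fixingSubgroups (n : ℕ) (H : Subgroup G) (φ : H →* Perm (Fin n)) :
    graphSubgroup H φ ∈ fixingSubgroups G n := by
  have hmem : ∀ x : G, (QuotientGroup.mk x : G ⧸ H).out⁻¹ * x ∈ H := fun x =>
    QuotientGroup.eq.1 (QuotientGroup.out_eq' _)
  refine ⟨fun x => φ ⟨_, hmem x⟩, ?_⟩
  rintro _ ⟨h, rfl⟩ x
  change φ _ = φ _ * φ h
  rw [← map_mul]
  have : (QuotientGroup.mk (x * (h : G)) : G ⧸ H) = QuotientGroup.mk x :=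
    QuotientGroup.mk_mul_of_mem x h.2
  refine congr_arg φ (Subtype.ext ?_)
  change (QuotientGroup.mk (x * (h : G)) : G ⧸ H).out⁻¹ * (x * h) = _ * x * h
  rw [this, mul_assoc]

theorem prod_bot_mem_fixingSubgroups (n : ℕ) (H : Subgroup G) :
    H.prod ⊥ ∈ fixingSubgroups G n :=
  ⟨fun _ => 1, fun γ hγ x => by simpa using (Subgroup.mem_prod.1 hγ).2.symm⟩

theorem act_barrattEcclesObj_eq_iff {n : ℕ} (γ : G × Perm (Fin n)) (p : G → Perm (Fin n)) :
    (fun x => p (x * γ.1) * γ.2⁻¹) = p ↔ ∀ x, p (x * γ.1) = p x * γ.2 := by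
  rw [funext_iff]
  exact forall_congr' fun x => mul_inv_eq_iff_eq_mul

theorem act_suboperad_eq_iff (N : (barrattEcclesObj G).Suboperad) {n : ℕ} (γ : G × Perm (Fin n))
    (p : G → Perm (Fin n)) (hp : p ∈ N.carrier n) :
    (N.toOperad.chaotic.act n γ).obj ⟨⟨p, hp⟩⟩ = ⟨⟨p, hp⟩⟩ ↔ ∀ x, p (x * γ.1) = p x * γ.2 :=
  Iff.trans ⟨fun h => congr_arg (fun q : Codiscrete (N.toOperad.Op n) => q.as.1) h,
    fun h => Codiscrete.ext (Subtype.ext h)⟩ (act_barrattEcclesObj_eq_iff γ p)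

/-- The point where the algebra enters: replacing `p` by the operation of `exists_mem_of_fixed`
shows that the suboperad loses no fixed points. -/
theorem mem_fixingSubgroups_iff [Finite G] {𝔒 : Set (OrderedGSet.{u, v} G)}
    (h𝔒 : IsCompleteSetOfOrbits 𝔒) (n : ℕ) (Γ : Subgroup (G × Perm (Fin n))) :
    Γ ∈ fixingSubgroups G n ↔ ∃ f : (completeSuboperad G 𝔒).C n,
      ∀ γ ∈ Γ, ((completeSuboperad G 𝔒).act n γ).obj f = f := by
  refine ⟨fun ⟨p, hp⟩ => ?_, fun ⟨f, hf⟩ => ⟨f.as.1, fun γ hγ => ?_⟩⟩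
  · obtain ⟨q, hq, h⟩ := exists_mem_of_fixed h𝔒 p
    exact ⟨⟨⟨q, hq⟩⟩, fun γ hγ => (act_suboperad_eq_iff _ γ q hq).2 (h γ.1 γ.2 (hp γ hγ))⟩
  · exact (act_suboperad_eq_iff _ γ f.as.1 f.as.2).1 (hf γ hγ)

theorem isNInftyWith_completeSuboperad [Finite G] {𝔒 : Set (OrderedGSet.{u, v} G)}
    (h𝔒 : IsCompleteSetOfOrbits 𝔒) :
    (completeSuboperad G 𝔒).IsNInftyWith (fixingSubgroups G) where
  contractible_zero := by
    obtain ⟨f, hf⟩ := (mem_fixingSubgroups_iff h𝔒 0 ⊤).1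
      ⟨fun _ => 1, fun _ _ _ => Subsingleton.elim _ _⟩
    obtain ⟨x₀, h1, H, h2⟩ := isEquivariantlyContractible_space ⊤ f hf
    exact ⟨x₀, fun k => h1 ⟨k, trivial⟩, H, fun k => h2 ⟨k, trivial⟩⟩
  free n σ x hx := by
    have h : ((completeSuboperad G 𝔒).act n (1, σ)).obj (firstOp x) = firstOp x :=
      (firstOp_smul _ x).symm.trans (congr_arg firstOp hx)
    -- Freeness is cancellation in `Σₙ`, seen at the first vertex evaluated at `1 : G`.
    have aux : ∀ p : G → Perm (Fin n), p (1 * 1) = p 1 * σ → σ = 1 := fun p h => by simpa using h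
    exact aux _ ((act_suboperad_eq_iff _ (1, σ) (firstOp x).as.1 (firstOp x).as.2).1 h 1)
  family := isFamilyOfSubgroups_fixingSubgroups
  universal n := isUniversalSpace_chaotic n (mem_fixingSubgroups_iff h𝔒 n)
  prod_bot_mem := prod_bot_mem_fixingSubgroups

theorem completeSuboperadIncl_isEquivalence [Finite G] {𝔒 : Set (OrderedGSet.{u, v} G)}
    (h𝔒 : IsCompleteSetOfOrbits 𝔒) : (completeSuboperadIncl G 𝔒).IsEquivalence := by
  refine isEquivalence_of_fixed _ fun n Γ ⟨y⟩ => ?_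
  obtain ⟨f, hf⟩ := (mem_fixingSubgroups_iff h𝔒 n Γ).1 ⟨y.obj.as, fun γ hγ =>
    (act_barrattEcclesObj_eq_iff γ _).1 (congr_arg Codiscrete.as (y.fixed γ hγ))⟩
  exact ⟨⟨f, hf⟩⟩

end

end

theorem mainTheorem2 (G : Type u) [Group G] [Finite G] (𝔒 : Set (OrderedGSet.{u, v} G))
    (h𝔒 : IsCompleteSetOfOrbits 𝔒) :
    (completeSuboperadObj G 𝔒).toOperad.IsFinitelyGenerated ∧
    (completeSuboperad G 𝔒).IsGenuineEInfty ∧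
    (completeSuboperadIncl G 𝔒).IsEquivalence :=
  ⟨isFinitelyGenerated_completeSuboperadObj h𝔒,
    ⟨fixingSubgroups G, isNInftyWith_completeSuboperad h𝔒, graphSubgroup_mem_fixingSubgroups⟩,
    completeSuboperadIncl_isEquivalence h𝔒⟩
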